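/- Let $K$ be a field, let $K^\times=K\setminus\{0\}$, and let $\mathcal R\subseteq K^\times$ be a set containing $1$ and exactly one element of each coset of $(K^\times)^3=\{b^3: b\in K^\times\}$ in $K^\times$. Then $SL_3(K)$ is generated by the matrices $$\hat R(a)=\begin{pmatrix}a&0&0\\0&1&0\\0&0&a^{-1}\end{pmatrix}\ (a\in K^\times\setminus\{1\}),\quad \hat S=\begin{pmatrix}-1&1&0\\0&1&0\\0&0&-1\end{pmatrix},\quad \hat J=\begin{pmatrix}0&-1&0\\-1&0&0\\0&0&-1\end{pmatrix},\quad T=\begin{pmatrix}0&0&-1\\0&-1&0\\-1&0&0\end{pmatrix},$$ and, in terms of these generators, the following is a system of defining relations for $SL_3(K)$; that is, the kernel of the homomorphism onto $SL_3(K)$ from the free group on symbols $\hat R(a)$ $(a\in K^\times\setminus\{1\})$, $\hat S$, $\hat J$, $T$, sending each symbol to the matrix of the same name, is the normal closure of the elements $uv^{-1}$ for the relations $u=v$ in the list: (i) $\hat S^2=\hat J^2=T^2=1$; (ii) $\hat R(a)\hat R(b)=\hat R(ab)$ for $a,b\in K^\times\setminus\{1\}$; (iii) $\hat Z(a)\hat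 Z(b)=\hat Z(ab)$ for $a,b\in K^\times\setminus\{1\}$; (iv) $[\hat R(a),\hat Z(b)]=1$ for $a,b\in K^\times\setminus\{1\}$; (v) $[\hat S,\hat Z(a)]=1$ for $a\in K^\times\setminus\{1\}$; (vi) $[\hat S,\hat R(a)]=\hat E_{1,2}(1-a)$ for $a\in K^\times\setminus\{1\}$; (vii) $(\hat J\hat S)^3=(T\hat J)^3=1$; (viii) $(T\hat R(a))^2=1$ for $a\in K^\times\setminus\{1\}$; (ix) $[\hat Z(a),T]=\hat R(a)^3$ for $a\in K^\times\setminus\{1\}$; (x) $(\hat W\hat E_{1,2}(a))^2=1$ for $a\in\mathcal R$; (xi) $\hat W\hat J\hat R(a)\hat W=\rho_a\hat W\lambda_a$ for $a\in\mathcal R$. Here $[x,y]=xyx^{-1}y^{-1}$; $\hat R(1):=1$ and $\hat Z(1):=1$; $\hat Z(a):=(\hat J\hat R(a))^2$ for $a\in K^\times\setminus\{1\}$; $\hat E_{1,2}(a):=\hat R(a)\hat S\hat R(-a)^{-1}$ for $a\in K^\times$; $\hat W:=T\hat ST$; $\rho_a:=\hat E_{1,2}(-a)\hat J\hat R(a)$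 and $\lambda_a:=\hat E_{1,2}(-a^{-2})\hat J\hat E_{1,2}(a^2)\hat R(a)^4\hat Z(a)^{-2}$ for $a\in K^\times$. -/

import Mathlib

open scoped MatrixGroups commutatorElement

namespace SL3Pres

/-- The formal generators: one symbol `R a` for each `a ∈ Kˣ \ {1}`, and `S`, `J`, `T`. -/
inductive Gen (K : Type*) [Field K] : Type _
  | R (a : Kˣ) (ha : a ≠ 1) : Gen K
  | S : Gen K
  | J : Gen K
  | T : Gen K

/-! ### The matrices in `SL₃(K)` -/

/-- The diagonal matrix `diag(a, 1, a⁻¹)`. -/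
def matR {K : Type*} [Field K] (a : Kˣ) : SL(3, K) :=
  ⟨!![(a : K), 0, 0; 0, 1, 0; 0, 0, (a : K)⁻¹], by simp [Matrix.det_fin_three]⟩

def matS (K : Type*) [Field K] : SL(3, K) :=
  ⟨!![-1, 1, 0; 0, 1, 0; 0, 0, -1], by simp [Matrix.det_fin_three]⟩

def matJ (K : Type*) [Field K] : SL(3, K) :=
  ⟨!![0, -1, 0; -1, 0, 0; 0, 0, -1], by simp [Matrix.det_fin_three]⟩

def matT (K : Type*) [Field K] : SL(3, K) :=
  ⟨!![0, 0, -1; 0, -1, 0; -1, 0, 0], by simp [Matrix.det_fin_three]⟩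

/-- The matrix named by each formal generator. -/
def Gen.toSL {K : Type*} [Field K] : Gen K → SL(3, K)
  | .R a _ => matR a
  | .S => matS K
  | .J => matJ K
  | .T => matT K

/-! ### Words in the free group on the formal generators -/

open Classical in
/-- The word `R(a)`, with the convention `R(1) = 1`. -/
noncomputable def wR {K : Type*} [Field K] (a : Kˣ) : FreeGroup (Gen K) :=
  if ha : a = 1 then 1 else FreeGroup.of (Gen.R a ha)

def wS (K : Type*) [Field K] : FreeGroup (Gen K) := FreeGroup.of Gen.S

def wJ (K : Type*) [Field K] : FreeGroup (Gen K) := FreeGroup.of Gen.J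

def wT (K : Type*) [Field K] : FreeGroup (Gen K) := FreeGroup.of Gen.T

/-- The word `Z(a) = (J R(a))²` for `a ≠ 1`, with the convention `Z(1) = 1`. -/
noncomputable def wZ {K : Type*} [Field K] (a : Kˣ) : FreeGroup (Gen K) :=
  open Classical in if a = 1 then 1 else (wJ K * wR a) ^ 2

/-- The word `E₁₂(a) = R(a) S R(-a)⁻¹`. -/
noncomputable def wE {K : Type*} [Field K] (a : Kˣ) : FreeGroup (Gen K) :=
  wR a * wS K * (wR (-a))⁻¹

/-- The word `W = T S T`. -/
def wW (K : Type*) [Field K] : FreeGroup (Gen K) := wT K * wS K * wT K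

/-- The word `ρ_a = E₁₂(-a) J R(a)`. -/
noncomputable def wRho {K : Type*} [Field K] (a : Kˣ) : FreeGroup (Gen K) :=
  wE (-a) * wJ K * wR a

/-- The word `λ_a = E₁₂(-a⁻²) J E₁₂(a²) R(a)⁴ Z(a)⁻²`. -/
noncomputable def wLambda {K : Type*} [Field K] (a : Kˣ) : FreeGroup (Gen K) :=
  wE (-(a ^ 2)⁻¹) * wJ K * wE (a ^ 2) * wR a ^ 4 * (wZ a ^ 2)⁻¹

/-- The element `1 - a` of `Kˣ`, for `a ∈ Kˣ \ {1}`. -/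
def oneSub {K : Type*} [Field K] (a : Kˣ) (ha : a ≠ 1) : Kˣ :=
  Units.mk0 (1 - (a : K)) (sub_ne_zero.mpr fun h => ha (Units.ext h.symm))

/-- `Rel 𝓡 u v` says that `u = v` is one of the listed relations; commutators are
`⁅x, y⁆ = x * y * x⁻¹ * y⁻¹`. -/
inductive Rel {K : Type*} [Field K] (𝓡 : Set Kˣ) : FreeGroup (Gen K) → FreeGroup (Gen K) → Prop
  | S_sq : Rel 𝓡 (wS K ^ 2) 1
  | J_sq : Rel 𝓡 (wJ K ^ 2) 1
  | T_sq : Rel 𝓡 (wT K ^ 2) 1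
  | R_mul (a b : Kˣ) (ha : a ≠ 1) (hb : b ≠ 1) : Rel 𝓡 (wR a * wR b) (wR (a * b))
  | Z_mul (a b : Kˣ) (ha : a ≠ 1) (hb : b ≠ 1) : Rel 𝓡 (wZ a * wZ b) (wZ (a * b))
  | comm_R_Z (a b : Kˣ) (ha : a ≠ 1) (hb : b ≠ 1) : Rel 𝓡 ⁅wR a, wZ b⁆ 1
  | comm_S_Z (a : Kˣ) (ha : a ≠ 1) : Rel 𝓡 ⁅wS K, wZ a⁆ 1
  | comm_S_R (a : Kˣ) (ha : a ≠ 1) : Rel 𝓡 ⁅wS K, wR a⁆ (wE (oneSub a ha))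
  | JS_cube : Rel 𝓡 ((wJ K * wS K) ^ 3) 1
  | TJ_cube : Rel 𝓡 ((wT K * wJ K) ^ 3) 1
  | TR_sq (a : Kˣ) (ha : a ≠ 1) : Rel 𝓡 ((wT K * wR a) ^ 2) 1
  | comm_Z_T (a : Kˣ) (ha : a ≠ 1) : Rel 𝓡 ⁅wZ a, wT K⁆ (wR a ^ 3)
  | WE_sq (a : Kˣ) (ha : a ∈ 𝓡) : Rel 𝓡 ((wW K * wE a) ^ 2) 1
  | WJRW (a : Kˣ) (ha : a ∈ 𝓡) :
      Rel 𝓡 (wW K * wJ K * wR a * wW K) (wRho a * wW K * wLambda a)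

/-- The relators `u * v⁻¹`, one for each relation `u = v`. -/
def relators {K : Type*} [Field K] (𝓡 : Set Kˣ) : Set (FreeGroup (Gen K)) :=
  {w | ∃ u v, Rel 𝓡 u v ∧ w = u * v⁻¹}

/-- `𝓡` is a set of representatives (exactly one in each class) for `Kˣ / (Kˣ)³`. -/
def IsCubeReps {K : Type*} [Field K] (𝓡 : Set Kˣ) : Prop :=
  Set.BijOn (fun a : Kˣ => (a : Kˣ ⧸ (powMonoidHom 3 : Kˣ →* Kˣ).range)) 𝓡 Set.univ

end SL3Pres

/-! Let G be the presented group and π : G → SL₃(K) the induced map. The relators hold for the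
matrices and π is easily onto, so the content is that π is injective. This is shown on a growing
chain of subgroups of G, each with a normal form that can be read off from its image: the Borel
subgroup B of GL₂; the Levi subgroup L = B ∪ BJB over GL₂; the parabolic P = NL over the stabilizer
of the point ⟨e₃⟩; and finally G = P ∪ PTP, which mirrors the double transitivity of SL₃(K) on the
projective plane.

The delicate step is to find N ≅ K² inside G. Its nontrivial elements are the L-conjugates of y(1) =
T E₁₂(1) T. By relation (x), y(1) commutes in G with everything in L that fixes its image, so such a
conjugate is determined by its vector (u, v) (`IsRoot.ext`). Relation (xi) says that for certain
independent pairs the product is again a conjugate of y(1). The action of L on K² has determinants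
exactly the cubes, so the L-orbits of independent pairs correspond to Kˣ/(Kˣ)³, and one relation for
each a ∈ 𝓡 covers all pairs (`IsRoot.mul_of_ne`). Dependent pairs reduce to independent ones.

For the last stage, put D = P ∩ TPT, the stabilizer of ⟨e₁⟩ and ⟨e₃⟩. At matrix level P consists of
the D-double cosets of 1, J and JWJ (`exists_double_coset`). Injectivity on P lifts this to G, and
braid relations then give TPT ⊆ P ∪ PTP (`T_parabolic_T`). -/

namespace SL3Pres

/-! ### Matrix computations in SL₃(K) -/

section Matrices

variable {K : Type*} [Field K]

/-- The matrix with rows `(a, tb, 0)`, `(0, b, 0)`, `(0, vb, (ab)⁻¹)`. -/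
def matD (t v : K) (a b : Kˣ) : SL(3, K) :=
  ⟨!![(a : K), t * b, 0; 0, b, 0; 0, v * b, ((a : K) * b)⁻¹], by
    simp [Matrix.det_fin_three, mul_assoc]⟩

/-- The lower unitriangular matrix with last row `(u, v, 1)`. -/
def matLow (u v : K) : SL(3, K) :=
  ⟨!![1, 0, 0; 0, 1, 0; u, v, 1], by simp [Matrix.det_fin_three]⟩

/-- The matrix `T S T`. -/
def matW (K : Type*) [Field K] : SL(3, K) :=
  ⟨!![-1, 0, 0; 0, 1, 0; 0, 1, -1], by simp [Matrix.det_fin_three]⟩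

theorem coe_mul_apply (M N : SL(3, K)) (i j : Fin 3) :
    (M * N : SL(3, K)) i j = M i 0 * N 0 j + M i 1 * N 1 j + M i 2 * N 2 j := by
  rw [Matrix.SpecialLinearGroup.coe_mul, Matrix.mul_apply, Fin.sum_univ_three]

theorem coe_matD (t v : K) (a b : Kˣ) : (matD t v a b : Matrix (Fin 3) (Fin 3) K) =
    !![(a : K), t * b, 0; 0, b, 0; 0, v * b, ((a : K) * b)⁻¹] := rfl

theorem coe_matLow (u v : K) : (matLow u v : Matrix (Fin 3) (Fin 3) K) =
    !![1, 0, 0; 0, 1, 0; u, v, 1] := rfl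

theorem coe_matW : (matW K : Matrix (Fin 3) (Fin 3) K) =
    !![-1, 0, 0; 0, 1, 0; 0, 1, -1] := rfl

theorem coe_matR (a : Kˣ) : (matR a : Matrix (Fin 3) (Fin 3) K) =
    !![(a : K), 0, 0; 0, 1, 0; 0, 0, (a : K)⁻¹] := rfl

theorem coe_matS : (matS K : Matrix (Fin 3) (Fin 3) K) =
    !![-1, 1, 0; 0, 1, 0; 0, 0, -1] := rfl

theorem coe_matJ : (matJ K : Matrix (Fin 3) (Fin 3) K) =
    !![0, -1, 0; -1, 0, 0; 0, 0, -1] := rfl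

theorem coe_matT : (matT K : Matrix (Fin 3) (Fin 3) K) =
    !![0, 0, -1; 0, -1, 0; -1, 0, 0] := rfl

theorem matD_mul (t v t' v' : K) (a b a' b' : Kˣ) :
    matD t v a b * matD t' v' a' b' =
      matD (t + a / b * t') (v + v' / (a * b ^ 2)) (a * a') (b * b') := by
  ext i j
  fin_cases i <;> fin_cases j <;>
    simp [coe_matD, coe_mul_apply] <;>
    field_simp <;> ring

theorem matD_inj {t v t' v' : K} {a b a' b' : Kˣ}
    (h : matD t v a b = matD t' v' a' b') : t = t' ∧ v = v' ∧ a = a' ∧ b = b' := by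
  have h00 := congrArg (fun M : SL(3, K) => M 0 0) h
  have h11 := congrArg (fun M : SL(3, K) => M 1 1) h
  have h01 := congrArg (fun M : SL(3, K) => M 0 1) h
  have h21 := congrArg (fun M : SL(3, K) => M 2 1) h
  simp only [coe_matD] at h00 h11 h01 h21
  simp at h00 h11 h01 h21
  obtain rfl := Units.ext h11
  obtain rfl := Units.ext h00
  simpa using And.intro h01 h21

theorem matD_one : matD (0 : K) 0 1 1 = 1 := by
  ext i j
  fin_cases i <;> fin_cases j <;> simp [coe_matD]

theorem matD_inv (t v : K) (a b : Kˣ) :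
    (matD t v a b)⁻¹ = matD (-(b / a * t)) (-(v * (a * b ^ 2))) a⁻¹ b⁻¹ := by
  rw [inv_eq_iff_mul_eq_one, matD_mul, ← matD_one]
  congr 1 <;> (try simp) <;>
    field_simp <;> ring

theorem matR_eq (a : Kˣ) : matR a = matD 0 0 a 1 := by
  ext i j
  fin_cases i <;> fin_cases j <;> simp [coe_matD, coe_matR]

theorem matS_eq : matS K = matD 1 0 (-1) 1 := by
  ext i j
  fin_cases i <;> fin_cases j <;> simp [coe_matD, coe_matS]

theorem matLow_mul (u v u' v' : K) :
    matLow u v * matLow u' v' = matLow (u + u') (v + v') := by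
  ext i j
  fin_cases i <;> fin_cases j <;> simp [coe_matLow, coe_mul_apply]

theorem matLow_zero : matLow (0 : K) 0 = 1 := by
  ext i j
  fin_cases i <;> fin_cases j <;> simp [coe_matLow]

theorem matLow_inj {u v u' v' : K} : matLow u v = matLow u' v' ↔ u = u' ∧ v = v' := by
  refine ⟨fun h => ?_, fun ⟨h, h'⟩ => by rw [h, h']⟩
  have h0 := congrArg (fun M : SL(3, K) => M 2 0) h
  have h1 := congrArg (fun M : SL(3, K) => M 2 1) h
  simpa [matLow] using And.intro h0 h1

theorem matLow_eq_one {u v : K} : matLow u v = 1 ↔ u = 0 ∧ v = 0 := by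
  rw [← matLow_zero, matLow_inj]

theorem matJ_sq : matJ K * matJ K = 1 := by
  ext i j
  fin_cases i <;> fin_cases j <;> simp [coe_matJ, coe_mul_apply]

theorem matT_sq : matT K * matT K = 1 := by
  ext i j
  fin_cases i <;> fin_cases j <;> simp [coe_matT, coe_mul_apply]

theorem matJ_matD_matJ (a b : Kˣ) : matJ K * matD 0 0 a b * matJ K = matD 0 0 b a := by
  ext i j
  fin_cases i <;> fin_cases j <;>
    simp [coe_matJ, coe_matD, coe_mul_apply, mul_comm]

theorem matT_matD_matT (t v : K) (a b : Kˣ) :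
    matT K * matD t v a b * matT K = matD v t (a * b)⁻¹ b := by
  ext i j
  fin_cases i <;> fin_cases j <;>
    simp [coe_matT, coe_matD, coe_mul_apply]
  field_simp

theorem matW_eq : matW K = matT K * matS K * matT K := by
  rw [matS_eq, matT_matD_matT]
  ext i j
  fin_cases i <;> fin_cases j <;> simp [coe_matW, coe_matD]

theorem matW_eq_matD : matW K = matD 0 1 (-1) 1 := by
  ext i j
  fin_cases i <;> fin_cases j <;> simp [coe_matW, coe_matD]

theorem matD_conj_matLow (t : K) (a b : Kˣ) (u v : K) :
    matD t 0 a b * matLow u v =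
      matLow (u / (a ^ 2 * b)) ((v / b - t * u / a) / (a * b)) * matD t 0 a b := by
  ext i j
  fin_cases i <;> fin_cases j <;>
    simp [coe_matLow, coe_matD, coe_mul_apply] <;>
    field_simp <;> ring

theorem matJ_conj_matLow (u v : K) : matJ K * matLow u v = matLow v u * matJ K := by
  ext i j
  fin_cases i <;> fin_cases j <;>
    simp [coe_matLow, coe_matJ, coe_mul_apply]

theorem matD_eq_matLow (v : K) : matD 0 v 1 1 = matLow 0 v := by
  ext i j
  fin_cases i <;> fin_cases j <;> simp [coe_matLow, coe_matD]

theorem matJ_matS_cube : (matJ K * matS K) ^ 3 = 1 := by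
  ext i j
  fin_cases i <;> fin_cases j <;>
    simp [coe_matJ, coe_matS, pow_succ, coe_mul_apply]

theorem matT_matJ_cube : (matT K * matJ K) ^ 3 = 1 := by
  ext i j
  fin_cases i <;> fin_cases j <;>
    simp [coe_matJ, coe_matT, pow_succ, coe_mul_apply]

theorem matW_matJ_matR_matW (a : Kˣ) :
    matW K * matJ K * matR a * matW K = matD (-a : K) 0 1 1 * matJ K * matR a * matW K *
      (matD (-(a ^ 2 : K)⁻¹) 0 1 1 * matJ K * matD (a ^ 2 : K) 0 1 1 *
        matD 0 0 (a ^ 2) (a ^ 2)⁻¹) := by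
  ext i j
  fin_cases i <;> fin_cases j <;>
    simp [coe_matJ, coe_matD, coe_matR, coe_matW, coe_mul_apply] <;>
    field_simp <;> ring

theorem exists_eq_matD {M : SL(3, K)} (h02 : M 0 2 = 0) (h12 : M 1 2 = 0) (h10 : M 1 0 = 0)
    (h20 : M 2 0 = 0) : ∃ t v a b, M = matD t v a b := by
  have hd := M.det_coe
  rw [Matrix.det_fin_three] at hd
  simp only [h02, h12, h10, h20] at hd
  ring_nf at hd
  have ha : M 0 0 ≠ 0 := by rintro h; simp [h] at hd
  have hb : M 1 1 ≠ 0 := by rintro h; simp [h] at hd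
  refine ⟨M 0 1 / M 1 1, M 2 1 / M 1 1, Units.mk0 _ ha, Units.mk0 _ hb, ?_⟩
  ext i j
  fin_cases i <;> fin_cases j <;> simp [coe_matD, *]
  rw [← mul_inv_rev]
  exact eq_inv_of_mul_eq_one_right hd

/-- The stabilizer of a point of the projective plane decomposes into three double cosets modulo
the stabilizer of a second point. -/
theorem exists_double_coset {M : SL(3, K)} (h02 : M 0 2 = 0) (h12 : M 1 2 = 0) :
    ∃ t v a b t' v' a' b',
      M = matD t v a b * matD t' v' a' b' ∨
      M = matD t v a b * matJ K * matD t' v' a' b' ∨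
      M = matD t v a b * (matJ K * matW K * matJ K) * matD t' v' a' b' := by
  by_cases h10 : M 1 0 = 0
  · have hd := M.det_coe
    rw [Matrix.det_fin_three] at hd
    simp only [h02, h12, h10] at hd
    have ha : M 0 0 ≠ 0 := by rintro h; simp [h] at hd
    by_cases h20 : M 2 0 = 0
    · obtain ⟨t, v, a, b, h⟩ := exists_eq_matD h02 h12 h10 h20
      exact ⟨t, v, a, b, 0, 0, 1, 1, Or.inl (by rw [matD_one, mul_one, h])⟩
    · obtain ⟨a, ha⟩ : ∃ a : Kˣ, (a : K) = M 0 0 := ⟨Units.mk0 _ ha, rfl⟩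
      obtain ⟨x, hx⟩ : ∃ a : Kˣ, (a : K) = M 2 0 := ⟨Units.mk0 _ h20, rfl⟩
      -- The diagonal factor turns the first column (a, 0, x) into (1, 0, 1); JWJ then clears the
      -- last entry.
      obtain ⟨t, v, a', b', h⟩ := exists_eq_matD
        (M := (matJ K * matW K * matJ K) * matD 0 0 a⁻¹ (a * x) * M)
        (by simp [coe_matJ, coe_matW, coe_matD, coe_mul_apply, h02, h12])
        (by simp [coe_matJ, coe_matW, coe_matD, coe_mul_apply, h02, h12])
        (by simp [coe_matJ, coe_matW, coe_matD, coe_mul_apply, h10])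
        (by simp [coe_matJ, coe_matW, coe_matD, coe_mul_apply, h10, ← ha, ← hx])
      refine ⟨0, 0, a, (a * x)⁻¹, t, v, a', b', Or.inr (Or.inr ?_)⟩
      have hW : matW K * matW K = 1 := by
        rw [matW_eq_matD, matD_mul, ← matD_one]; simp
      have hJ := matJ_sq (K := K)
      have e1 : (matJ K * matW K * matJ K) * (matJ K * matW K * matJ K) = 1 := by
        calc _ = matJ K * matW K * (matJ K * matJ K) * matW K * matJ K := by group
          _ = matJ K * (matW K * matW K) * matJ K := by rw [hJ]; group
          _ = 1 := by rw [hW, mul_one, hJ]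
      have e2 : matD 0 0 a (a * x)⁻¹ * matD 0 0 a⁻¹ (a * x) = (1 : SL(3, K)) := by
        rw [matD_mul, ← matD_one]; simp
      rw [← h]
      calc M = (matD 0 0 a (a * x)⁻¹ * matD 0 0 a⁻¹ (a * x)) * M := by rw [e2, one_mul]
        _ = matD 0 0 a (a * x)⁻¹ * ((matJ K * matW K * matJ K) * (matJ K * matW K * matJ K)) *
            matD 0 0 a⁻¹ (a * x) * M := by rw [e1]; group
        _ = _ := by group
  · obtain ⟨c, hc⟩ : ∃ a : Kˣ, (a : K) = M 1 0 := ⟨Units.mk0 _ h10, rfl⟩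
    -- The middle entry c clears the other two entries of the first column, and J moves it to the
    -- top.
    obtain ⟨t, v, a', b', h⟩ := exists_eq_matD
        (M := matJ K * matD (-(M 0 0 / c)) (-(M 2 0 / c)) 1 1 * M)
        (by simp [coe_matJ, coe_matD, coe_mul_apply, h02, h12])
        (by simp [coe_matJ, coe_matD, coe_mul_apply, h02, h12])
        (by simp [coe_matJ, coe_matD, coe_mul_apply, ← hc])
        (by simp [coe_matJ, coe_matD, coe_mul_apply, ← hc])
    refine ⟨M 0 0 / c, M 2 0 / c, 1, 1, t, v, a', b', Or.inr (Or.inl ?_)⟩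
    rw [← h]
    have e2 : matD (M 0 0 / c) (M 2 0 / c) 1 1 * matD (-(M 0 0 / c)) (-(M 2 0 / c)) 1 1 =
        (1 : SL(3, K)) := by
      rw [matD_mul, ← matD_one]; simp
    calc M = (matD (M 0 0 / c) (M 2 0 / c) 1 1 * matD (-(M 0 0 / c)) (-(M 2 0 / c)) 1 1) * M := by
          rw [e2, one_mul]
      _ = matD (M 0 0 / c) (M 2 0 / c) 1 1 * (matJ K * matJ K) *
          matD (-(M 0 0 / c)) (-(M 2 0 / c)) 1 1 * M := by rw [matJ_sq]; group
      _ = _ := by group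

/-- `SL₃` is generated by the matrices `matD`, `matJ` and `matT`. -/
theorem eq_top_of_mem {H : Subgroup SL(3, K)} (hD : ∀ t v a b, matD t v a b ∈ H)
    (hJ : matJ K ∈ H) (hT : matT K ∈ H) : H = ⊤ := by
  have hQ : ∀ M : SL(3, K), M 0 2 = 0 → M 1 2 = 0 → M ∈ H := by
    intro M h02 h12
    have hW : matW K ∈ H := by rw [matW_eq_matD]; exact hD _ _ _ _
    obtain ⟨t, v, a, b, t', v', a', b', h | h | h⟩ := exists_double_coset h02 h12 <;> rw [h]
    · exact mul_mem (hD _ _ _ _) (hD _ _ _ _)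
    · exact mul_mem (mul_mem (hD _ _ _ _) hJ) (hD _ _ _ _)
    · exact mul_mem (mul_mem (hD _ _ _ _) (mul_mem (mul_mem hJ hW) hJ)) (hD _ _ _ _)
  have hX : ∀ M : SL(3, K), M 0 2 ≠ 0 → M ∈ H := by
    intro M h
    obtain ⟨c, hc⟩ : ∃ a : Kˣ, (a : K) = M 0 2 := ⟨Units.mk0 _ h, rfl⟩
    -- `A` carries the last column of `M` to a multiple of e₃, so `A * M` fixes the point ⟨e₃⟩.
    set A := matT K * matJ K * matD (-(M 1 2 / c)) (-(M 2 2 / c)) 1 1 * matJ K with hA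
    have hAH : A ∈ H := mul_mem (mul_mem (mul_mem hT hJ) (hD _ _ _ _)) hJ
    refine (Subgroup.mul_mem_cancel_left H hAH).1 (hQ _ ?_ ?_) <;>
    simp [hA, coe_matT, coe_matJ, coe_matD, coe_mul_apply, ← hc]
  refine eq_top_iff.2 fun M _ => ?_
  by_cases h02 : M 0 2 = 0
  · by_cases h12 : M 1 2 = 0
    · exact hQ M h02 h12
    · refine (Subgroup.mul_mem_cancel_left H hJ).1 (hX _ ?_)
      simpa [coe_matJ, coe_mul_apply] using h12
  · exact hX M h02

end Matrices

/-! ### Subgroups of the form P ∪ PtP -/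

section DoubleCosets

variable {G : Type*} [Group G]

/-- If `t` is an involution and `t P t ⊆ P ∪ P t P`, then `P ∪ P t P` is a subgroup. -/
def doubleCosetSubgroup (P : Subgroup G) (t : G) (ht : t * t = 1)
    (h : ∀ p ∈ P, t * p * t ∈ P ∨ ∃ q ∈ P, ∃ r ∈ P, t * p * t = q * t * r) : Subgroup G where
  carrier := {g | g ∈ P ∨ ∃ q ∈ P, ∃ r ∈ P, g = q * t * r}
  one_mem' := Or.inl P.one_mem
  inv_mem' := by
    have ht' : t⁻¹ = t := inv_eq_of_mul_eq_one_left ht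
    rintro g (hg | ⟨q, hq, r, hr, rfl⟩)
    · exact Or.inl (P.inv_mem hg)
    · exact Or.inr ⟨r⁻¹, P.inv_mem hr, q⁻¹, P.inv_mem hq, by simp [ht', mul_assoc]⟩
  mul_mem' := by
    rintro g g' (hg | ⟨q, hq, r, hr, rfl⟩) (hg' | ⟨q', hq', r', hr', rfl⟩)
    · exact Or.inl (P.mul_mem hg hg')
    · exact Or.inr ⟨g * q', P.mul_mem hg hq', r', hr', by group⟩
    · exact Or.inr ⟨q, hq, r * g', P.mul_mem hr hg', by group⟩
    · have e : q * t * r * (q' * t * r') = q * (t * (r * q') * t) * r' := by group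
      rw [e]
      rcases h _ (P.mul_mem hr hq') with h | ⟨s, hs, s', hs', h⟩
      · exact Or.inl (P.mul_mem (P.mul_mem hq h) hr')
      · rw [h]
        exact Or.inr ⟨q * s, P.mul_mem hq hs, s' * r', P.mul_mem hs' hr', by group⟩

theorem le_doubleCosetSubgroup {P : Subgroup G} {t : G} (ht : t * t = 1)
    (h : ∀ p ∈ P, t * p * t ∈ P ∨ ∃ q ∈ P, ∃ r ∈ P, t * p * t = q * t * r) :
    P ≤ doubleCosetSubgroup P t ht h := fun _ hp => Or.inl hp

theorem mem_doubleCosetSubgroup {P : Subgroup G} {t : G} (ht : t * t = 1)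
    (h : ∀ p ∈ P, t * p * t ∈ P ∨ ∃ q ∈ P, ∃ r ∈ P, t * p * t = q * t * r) :
    t ∈ doubleCosetSubgroup P t ht h :=
  Or.inr ⟨1, P.one_mem, 1, P.one_mem, by simp⟩

/-- An element q t r killed by π would put π t into π(P), so the kernel lies in P. This carries
injectivity from P to P ∪ PtP. -/
theorem eq_one_of_mem_doubleCosetSubgroup {H : Type*} [Group H] (π : G →* H) {P : Subgroup G}
    {t : G} (ht : t * t = 1)
    (h : ∀ p ∈ P, t * p * t ∈ P ∨ ∃ q ∈ P, ∃ r ∈ P, t * p * t = q * t * r)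
    (hinj : ∀ p ∈ P, π p = 1 → p = 1) (hne : ∀ p ∈ P, π p ≠ π t)
    {g : G} (hg : g ∈ doubleCosetSubgroup P t ht h) (hπ : π g = 1) : g = 1 := by
  rcases hg with hg | ⟨q, hq, r, hr, rfl⟩
  · exact hinj g hg hπ
  · refine absurd ?_ (hne _ (P.mul_mem (P.inv_mem hq) (P.inv_mem hr)))
    rw [map_mul, map_mul] at hπ
    rw [map_mul, map_inv, map_inv]
    calc (π q)⁻¹ * (π r)⁻¹ = (π q)⁻¹ * (π q * π t * π r) * (π r)⁻¹ := by rw [hπ, mul_one]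
      _ = π t := by group

theorem braid_of_cube {s t : G} (hs : s * s = 1) (ht : t * t = 1) (h : (s * t) ^ 3 = 1) :
    s * t * s = t * s * t := by
  have hs' : s⁻¹ = s := inv_eq_of_mul_eq_one_left hs
  have ht' : t⁻¹ = t := inv_eq_of_mul_eq_one_left ht
  have h' : s * t * s * (t * s * t) = 1 := by
    rw [← h, pow_succ, pow_two]; group
  rw [eq_inv_of_mul_eq_one_left h']
  simp [hs', ht', mul_assoc]

end DoubleCosets

/-! ### Groups over SL₃(K) satisfying the relations -/

/-- Elements of a group named after the generators of the presentation. -/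
structure Frame (K : Type*) [Field K] (G : Type*) where
  R : Kˣ → G
  S : G
  J : G
  T : G

namespace Frame

variable {K : Type*} [Field K] {G : Type*} [Group G] (F : Frame K G)

def Z (a : Kˣ) : G := (F.J * F.R a) ^ 2

def E (a : Kˣ) : G := F.R a * F.S * (F.R (-a))⁻¹

def W : G := F.T * F.S * F.T

end Frame

/-- A group over `SL₃(K)` with elements that lie over the generators and satisfy the relations of
the presentation. -/
structure Realization (K : Type*) [Field K] (𝓡 : Set Kˣ) (G : Type*) [Group G] extends
    Frame K G where
  π : G →* SL(3, K)
  π_R : ∀ a, π (R a) = matR a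
  π_S : π S = matS K
  π_J : π J = matJ K
  π_T : π T = matT K
  R_one : R 1 = 1
  S_sq : S * S = 1
  J_sq : J * J = 1
  T_sq : T * T = 1
  R_mul : ∀ a b, R a * R b = R (a * b)
  Z_mul : ∀ a b, toFrame.Z a * toFrame.Z b = toFrame.Z (a * b)
  comm_R_Z : ∀ a b, Commute (R a) (toFrame.Z b)
  comm_S_Z : ∀ a, Commute S (toFrame.Z a)
  comm_S_R : ∀ a (ha : a ≠ 1), ⁅S, R a⁆ = toFrame.E (oneSub a ha)
  JS_cube : (J * S) ^ 3 = 1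
  TJ_cube : (T * J) ^ 3 = 1
  TR_sq : ∀ a, (T * R a) ^ 2 = 1
  comm_Z_T : ∀ a, ⁅toFrame.Z a, T⁆ = R a ^ 3
  WE_sq : ∀ a ∈ 𝓡, (toFrame.W * toFrame.E a) ^ 2 = 1
  WJRW : ∀ a ∈ 𝓡, toFrame.W * J * R a * toFrame.W =
    (toFrame.E (-a) * J * R a) * toFrame.W *
      (toFrame.E (-(a ^ 2)⁻¹) * J * toFrame.E (a ^ 2) * R a ^ 4 * (toFrame.Z a ^ 2)⁻¹)

/-! ### The root subgroup E₁₂ and the torus -/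

namespace Realization

variable {K : Type*} [Field K] {𝓡 : Set Kˣ} {G : Type*} [Group G] (F : Realization K 𝓡 G)

theorem R_inv (a : Kˣ) : (F.R a)⁻¹ = F.R a⁻¹ := by
  rw [inv_eq_iff_mul_eq_one, F.R_mul, mul_inv_cancel, F.R_one]

theorem Z_one : F.Z 1 = 1 := by simp [Frame.Z, F.R_one, pow_two, F.J_sq]

theorem Z_inv (a : Kˣ) : (F.Z a)⁻¹ = F.Z a⁻¹ := by
  rw [inv_eq_iff_mul_eq_one, F.Z_mul, mul_inv_cancel, F.Z_one]

theorem S_inv : F.S⁻¹ = F.S := inv_eq_of_mul_eq_one_left F.S_sq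

theorem J_inv : F.J⁻¹ = F.J := inv_eq_of_mul_eq_one_left F.J_sq

theorem T_inv : F.T⁻¹ = F.T := inv_eq_of_mul_eq_one_left F.T_sq

theorem E_eq (a : Kˣ) : F.E a = F.R a * F.S * F.R (-a⁻¹) := by
  simp [Frame.E, F.R_inv, inv_neg]

theorem R_conj_E (b a : Kˣ) : F.R b * F.E a * (F.R b)⁻¹ = F.E (b * a) := by
  have h1 : F.R (-(b * a)⁻¹) = F.R (-a⁻¹) * F.R b⁻¹ := by
    rw [F.R_mul, mul_inv_rev, neg_mul]
  rw [F.E_eq, F.E_eq, h1, ← F.R_mul b a, F.R_inv]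
  group

theorem E_one : F.E 1 = F.S * F.R (-1) := by
  rw [F.E_eq, F.R_one, one_mul, inv_one]

theorem E_one_mul_E_neg_one : F.E 1 * F.E (-1) = 1 := by
  rw [F.E_one, F.E_eq, inv_neg, neg_neg, inv_one, F.R_one, mul_one]
  calc F.S * F.R (-1) * (F.R (-1) * F.S) = F.S * (F.R (-1) * F.R (-1)) * F.S := by group
    _ = 1 := by rw [F.R_mul]; simp [F.R_one, F.S_sq]

/-- Relation (vi) unwound: it encodes the additive law with first parameter 1, and scaling by the
torus yields the rest. -/
theorem E_one_mul_E_neg (a : Kˣ) (ha : a ≠ 1) : F.E 1 * F.E (-a) = F.E (oneSub a ha) := by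
  rw [← F.comm_S_R, F.E_one, F.E_eq, inv_neg, neg_neg, commutatorElement_def, F.S_inv, F.R_inv]
  calc F.S * F.R (-1) * (F.R (-a) * F.S * F.R a⁻¹)
      = F.S * (F.R (-1) * F.R (-a)) * F.S * F.R a⁻¹ := by group
    _ = _ := by rw [F.R_mul]; simp

open Classical in
/-- The element lying over the elementary matrix `E₁₂(t)`. -/
noncomputable def x (t : K) : G := if h : t = 0 then 1 else F.E (Units.mk0 t h)

theorem x_zero : F.x 0 = 1 := by simp [x]

theorem x_unit (a : Kˣ) : F.x a = F.E a := by simp [x]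

theorem x_one : F.x 1 = F.E 1 := by simpa using F.x_unit 1

theorem E_one_mul_x (t : K) : F.E 1 * F.x t = F.x (1 + t) := by
  by_cases ht : t = 0
  · rw [ht, F.x_zero, mul_one, add_zero, F.x_one]
  obtain ⟨a, rfl⟩ : ∃ a : Kˣ, ((-a : Kˣ) : K) = t := ⟨-Units.mk0 t ht, by simp⟩
  rw [F.x_unit]
  by_cases ha : a = 1
  · subst ha
    rw [F.E_one_mul_E_neg_one]
    simp [F.x_zero]
  · rw [F.E_one_mul_E_neg a ha, ← F.x_unit]
    simp [oneSub, sub_eq_add_neg]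

theorem R_conj_x (b : Kˣ) (t : K) : F.R b * F.x t * (F.R b)⁻¹ = F.x (b * t) := by
  by_cases ht : t = 0
  · simp [ht, F.x_zero]
  obtain ⟨a, rfl⟩ : ∃ a : Kˣ, (a : K) = t := ⟨Units.mk0 t ht, rfl⟩
  rw [F.x_unit, F.R_conj_E, ← F.x_unit, Units.val_mul]

/-- Conjugation by `R a` multiplies parameters by a, so the sum a + u reduces to 1 + u / a. -/
theorem x_add (t u : K) : F.x t * F.x u = F.x (t + u) := by
  by_cases ht : t = 0
  · simp [ht, F.x_zero]
  obtain ⟨a, rfl⟩ : ∃ a : Kˣ, (a : K) = t := ⟨Units.mk0 t ht, rfl⟩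
  have h1 : F.x (a : K) = F.R a * F.E 1 * (F.R a)⁻¹ := by
    rw [F.R_conj_E, mul_one, F.x_unit]
  have h2 : F.x u = F.R a * F.x (u / a) * (F.R a)⁻¹ := by
    rw [F.R_conj_x]; congr 1; field_simp
  have h3 : F.x (a + u) = F.R a * F.x (1 + u / a) * (F.R a)⁻¹ := by
    rw [F.R_conj_x]; congr 1; field_simp
  rw [h1, h2, h3, ← F.E_one_mul_x]
  group

theorem x_inv (t : K) : (F.x t)⁻¹ = F.x (-t) := by
  rw [inv_eq_iff_mul_eq_one, F.x_add, add_neg_cancel, F.x_zero]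

theorem comm_Z_x (a : Kˣ) (t : K) : Commute (F.Z a) (F.x t) := by
  by_cases ht : t = 0
  · rw [ht, F.x_zero]; exact Commute.one_right _
  · rw [x, dif_neg ht, F.E_eq]
    exact (((F.comm_R_Z _ a).symm.mul_right (F.comm_S_Z a).symm)).mul_right (F.comm_R_Z _ a).symm

/-- The element lying over the diagonal matrix `diag(a, b, (ab)⁻¹)`. -/
def h (a b : Kˣ) : G := F.R (a / b) * F.Z b

theorem h_mul (a b a' b' : Kˣ) : F.h a b * F.h a' b' = F.h (a * a') (b * b') := by
  simp only [h]
  calc _ = F.R (a / b) * (F.Z b * F.R (a' / b')) * F.Z b' := by group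
    _ = F.R (a / b) * F.R (a' / b') * (F.Z b * F.Z b') := by
      rw [(F.comm_R_Z (a' / b') b).symm.eq]; group
    _ = _ := by rw [F.R_mul, F.Z_mul, mul_div_mul_comm]

theorem h_one : F.h 1 1 = 1 := by simp [h, F.R_one, F.Z_one]

theorem h_inv (a b : Kˣ) : (F.h a b)⁻¹ = F.h a⁻¹ b⁻¹ := by
  rw [inv_eq_iff_mul_eq_one, F.h_mul, mul_inv_cancel, mul_inv_cancel, F.h_one]

theorem R_eq_h (a : Kˣ) : F.R a = F.h a 1 := by simp [h, F.Z_one]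

theorem Z_eq_h (a : Kˣ) : F.Z a = F.h a a := by simp [h, F.R_one]

theorem h_mul_x (a b : Kˣ) (t : K) : F.h a b * F.x t = F.x (a / b * t) * F.h a b := by
  rw [h, mul_assoc, (F.comm_Z_x b t).eq, ← mul_assoc, ← mul_assoc]
  congr 1
  rw [← Units.val_div_eq_div_val, ← F.R_conj_x]
  group

theorem S_eq : F.S = F.x 1 * F.R (-1) := by
  rw [F.x_one, F.E_one, mul_assoc, F.R_mul]
  simp [F.R_one]

/-- This is the definition Z(a) = (J R(a))², solved for J R(a) J. -/
theorem J_R_J (a : Kˣ) : F.J * F.R a * F.J = F.h 1 a := by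
  have h1 : F.J * F.R a * F.J = F.Z a * (F.R a)⁻¹ := by
    rw [Frame.Z, pow_two]; group
  rw [h1, F.R_inv, (F.comm_R_Z _ a).symm.eq, h, one_div]

theorem J_Z_J (a : Kˣ) : F.J * F.Z a * F.J = F.Z a := by
  calc F.J * F.Z a * F.J = (F.J * F.J) * F.R a * (F.J * F.R a * F.J) := by
        rw [Frame.Z, pow_two]; group
    _ = F.Z a := by
        rw [F.J_sq, F.J_R_J, h, one_mul, ← mul_assoc, F.R_mul]; simp [F.R_one]

theorem J_h_J (a b : Kˣ) : F.J * F.h a b * F.J = F.h b a := by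
  calc F.J * F.h a b * F.J = (F.J * F.R (a / b) * F.J) * (F.J * F.J)⁻¹ * (F.J * F.Z b * F.J) := by
        rw [h]; group
    _ = F.h b a := by
        rw [F.J_sq, inv_one, mul_one, F.J_R_J, F.J_Z_J, F.Z_eq_h, F.h_mul]; simp

theorem J_S_J : F.J * F.S * F.J = F.S * F.J * F.S := braid_of_cube F.J_sq F.S_sq F.JS_cube

theorem T_J_T : F.T * F.J * F.T = F.J * F.T * F.J := braid_of_cube F.T_sq F.J_sq F.TJ_cube

theorem T_R_T (a : Kˣ) : F.T * F.R a * F.T = F.R a⁻¹ := by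
  rw [← F.R_inv, eq_inv_iff_mul_eq_one, ← F.TR_sq a, pow_two]
  group

/-- Relation (viii) gives the action of T on the `R` factor and relation (ix) the action on the `Z`
factor. -/
theorem T_h_T (a b : Kˣ) : F.T * F.h a b * F.T = F.h (a * b)⁻¹ b := by
  have hZ : F.T * F.Z b * F.T = F.R (b⁻¹ ^ 3) * F.Z b := by
    have h1 := F.comm_Z_T b⁻¹
    rw [commutatorElement_def, F.T_inv, F.Z_inv, inv_inv, ← F.Z_inv] at h1
    have h2 : F.R b⁻¹ ^ 3 = F.R (b⁻¹ ^ 3) := by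
      simp only [pow_succ, pow_zero, one_mul, F.R_mul]
    rw [← h2, (((F.comm_R_Z b⁻¹ b).pow_left 3)).eq, ← h1]
    group
  calc F.T * F.h a b * F.T = (F.T * F.R (a / b) * F.T) * (F.T * F.T)⁻¹ * (F.T * F.Z b * F.T) := by
        rw [h]; group
    _ = F.h (a * b)⁻¹ b := by
        rw [F.T_sq, inv_one, mul_one, F.T_R_T, hZ, ← mul_assoc, F.R_mul, h]
        congr 2
        rw [div_eq_mul_inv, div_eq_mul_inv, mul_inv, mul_inv, inv_inv]
        have : b * b⁻¹ ^ 3 = b⁻¹ * b⁻¹ := by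
          rw [pow_succ', pow_two, mul_inv_cancel_left]
        rw [mul_assoc, this, mul_assoc]

theorem π_Z (a : Kˣ) : F.π (F.Z a) = matD 0 0 a a := by
  rw [Frame.Z, pow_two, map_mul, map_mul, F.π_J, F.π_R, matR_eq]
  calc matJ K * matD 0 0 a 1 * (matJ K * matD 0 0 a 1)
      = matJ K * matD 0 0 a 1 * matJ K * matD 0 0 a 1 := by group
    _ = _ := by rw [matJ_matD_matJ, matD_mul]; simp

theorem π_h (a b : Kˣ) : F.π (F.h a b) = matD 0 0 a b := by
  rw [h, map_mul, F.π_R, F.π_Z, matR_eq, matD_mul]; simp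

theorem π_x (t : K) : F.π (F.x t) = matD t 0 1 1 := by
  by_cases ht : t = 0
  · simp [ht, F.x_zero, matD_one]
  obtain ⟨a, rfl⟩ : ∃ a : Kˣ, (a : K) = t := ⟨Units.mk0 t ht, rfl⟩
  rw [F.x_unit, F.E_eq, map_mul, map_mul, F.π_R, F.π_R, F.π_S, matR_eq, matR_eq, matS_eq,
    matD_mul, matD_mul]
  simp

end Realization

/-! ### The Borel and Levi subgroups over GL₂ -/

namespace Realization

variable {K : Type*} [Field K] {𝓡 : Set Kˣ} {G : Type*} [Group G] (F : Realization K 𝓡 G)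

/-- The elements lying over upper triangular matrices in `GL₂(K)`. -/
def borel : Subgroup G where
  carrier := {g | ∃ t a b, g = F.x t * F.h a b}
  one_mem' := ⟨0, 1, 1, by rw [F.x_zero, F.h_one, one_mul]⟩
  mul_mem' := by
    rintro _ _ ⟨t, a, b, rfl⟩ ⟨t', a', b', rfl⟩
    refine ⟨t + a / b * t', a * a', b * b', ?_⟩
    rw [← F.x_add, ← F.h_mul]
    calc _ = F.x t * (F.h a b * F.x t') * F.h a' b' := by group
      _ = _ := by rw [F.h_mul_x]; group
  inv_mem' := by
    rintro _ ⟨t, a, b, rfl⟩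
    exact ⟨_, _, _, by rw [mul_inv_rev, F.x_inv, F.h_inv, F.h_mul_x]⟩

theorem x_mem_borel (t : K) : F.x t ∈ F.borel := ⟨t, 1, 1, by rw [F.h_one, mul_one]⟩

theorem h_mem_borel (a b : Kˣ) : F.h a b ∈ F.borel := ⟨0, a, b, by rw [F.x_zero, one_mul]⟩

theorem S_mem_borel : F.S ∈ F.borel := by
  rw [F.S_eq, F.R_eq_h]; exact mul_mem (F.x_mem_borel _) (F.h_mem_borel _ _)

theorem π_x_mul_h (t : K) (a b : Kˣ) : F.π (F.x t * F.h a b) = matD t 0 a b := by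
  rw [map_mul, F.π_x, F.π_h, matD_mul]; simp

/-- J normalizes the torus. For t ≠ 0, writing E₁₂(t) as R S R exposes J S J = S J S, which lies in
the big cell. -/
theorem J_borel_J (p : G) (hp : p ∈ F.borel) : F.J * p * F.J ∈ F.borel ∨
    ∃ q ∈ F.borel, ∃ r ∈ F.borel, F.J * p * F.J = q * F.J * r := by
  obtain ⟨t, a, b, rfl⟩ := hp
  by_cases ht : t = 0
  · left
    rw [ht, F.x_zero, one_mul, F.J_h_J]
    exact F.h_mem_borel _ _
  right
  obtain ⟨c, rfl⟩ : ∃ a : Kˣ, (a : K) = t := ⟨Units.mk0 t ht, rfl⟩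
  refine ⟨F.h 1 c * F.S, mul_mem (F.h_mem_borel _ _) F.S_mem_borel,
    F.S * (F.h 1 (-c⁻¹) * F.h b a),
    mul_mem F.S_mem_borel (mul_mem (F.h_mem_borel _ _) (F.h_mem_borel _ _)), ?_⟩
  have hJ := F.J_inv
  rw [← F.J_h_J a b, ← F.J_R_J, ← F.J_R_J, F.x_unit, F.E_eq]
  calc _ = F.J * F.R c * F.S * F.R (-c⁻¹) * F.h a b * F.J := by group
    _ = F.J * F.R c * F.J⁻¹ * (F.J * F.S * F.J) * F.J⁻¹ * F.R (-c⁻¹) * F.J * F.J⁻¹ *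
        F.h a b * F.J := by group
    _ = _ := by rw [F.J_S_J, hJ]; simp only [mul_assoc]

/-- The subgroup lying over `GL₂(K)`. -/
def levi : Subgroup G := doubleCosetSubgroup F.borel F.J F.J_sq F.J_borel_J

theorem borel_le_levi : F.borel ≤ F.levi := le_doubleCosetSubgroup _ _

theorem J_mem_levi : F.J ∈ F.levi := mem_doubleCosetSubgroup _ _

theorem R_mem_levi (a : Kˣ) : F.R a ∈ F.levi := by
  rw [F.R_eq_h]; exact F.borel_le_levi (F.h_mem_borel _ _)

theorem Z_mem_levi (a : Kˣ) : F.Z a ∈ F.levi := by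
  rw [F.Z_eq_h]; exact F.borel_le_levi (F.h_mem_borel _ _)

theorem E_mem_levi (a : Kˣ) : F.E a ∈ F.levi := by
  rw [← F.x_unit]; exact F.borel_le_levi (F.x_mem_borel _)

/-- The parameters of a Borel element are visible in its matrix, and J is not upper triangular. -/
theorem eq_one_of_mem_levi {g : G} (hg : g ∈ F.levi) (h : F.π g = 1) : g = 1 := by
  refine eq_one_of_mem_doubleCosetSubgroup F.π F.J_sq F.J_borel_J ?_ ?_ hg h
  · rintro _ ⟨t, a, b, rfl⟩ h
    rw [F.π_x_mul_h, ← matD_one] at h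
    obtain ⟨rfl, -, rfl, rfl⟩ := matD_inj h
    rw [F.x_zero, F.h_one, one_mul]
  · rintro _ ⟨t, a, b, rfl⟩ h
    rw [F.π_x_mul_h, F.π_J] at h
    have h10 := congrArg (fun M : SL(3, K) => M 1 0) h
    simp [coe_matD, coe_matJ] at h10

theorem π_levi {g : G} (hg : g ∈ F.levi) :
    F.π g 0 2 = 0 ∧ F.π g 1 2 = 0 ∧ F.π g 2 0 = 0 ∧ F.π g 2 1 = 0 := by
  rcases hg with ⟨t, a, b, rfl⟩ | ⟨_, ⟨t, a, b, rfl⟩, _, ⟨t', a', b', rfl⟩, rfl⟩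
  · rw [F.π_x_mul_h]; simp [coe_matD]
  · rw [map_mul, map_mul, F.π_x_mul_h, F.π_x_mul_h, F.π_J]
    simp [coe_matD, coe_matJ, coe_mul_apply]

theorem mem_borel_of_mem_levi {g : G} (hg : g ∈ F.levi) (h : F.π g 1 0 = 0) : g ∈ F.borel := by
  rcases hg with hg | ⟨_, ⟨t, a, b, rfl⟩, _, ⟨t', a', b', rfl⟩, rfl⟩
  · exact hg
  · rw [map_mul, map_mul, F.π_x_mul_h, F.π_x_mul_h, F.π_J] at h
    simp [coe_matD, coe_matJ, coe_mul_apply] at h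

/-- Linearity of the action on (u, v) is what later shows that conjugation preserves linear
dependence. -/
theorem π_levi_conj_linear {g : G} (hg : g ∈ F.levi) : ∃ p q r s : K, ∀ u v,
    F.π g * matLow u v * (F.π g)⁻¹ = matLow (p * u + q * v) (r * u + s * v) := by
  have hB : ∀ t a b, ∃ p r s : K, ∀ u v, matD t 0 a b * matLow u v * (matD t 0 a b)⁻¹ =
      (matLow (p * u) (r * u + s * v) : SL(3, K)) := fun t a b =>
    ⟨1 / (a ^ 2 * b), -t / (a ^ 2 * b), 1 / (a * b ^ 2), fun u v => by
      rw [matD_conj_matLow, mul_inv_cancel_right]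
      congr 1 <;> field_simp
      ring⟩
  rcases hg with ⟨t, a, b, rfl⟩ | ⟨_, ⟨t, a, b, rfl⟩, _, ⟨t', a', b', rfl⟩, rfl⟩
  · obtain ⟨p, r, s, h⟩ := hB t a b
    exact ⟨p, 0, r, s, fun u v => by rw [F.π_x_mul_h, h, zero_mul, add_zero]⟩
  · rw [map_mul, map_mul, F.π_x_mul_h, F.π_x_mul_h, F.π_J]
    obtain ⟨p, r, s, h⟩ := hB t a b
    obtain ⟨p', r', s', h'⟩ := hB t' a' b'
    refine ⟨p * r', p * s', r * r' + s * p', r * s', fun u v => ?_⟩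
    calc _ = matD t 0 a b * (matJ K * (matD t' 0 a' b' * matLow u v * (matD t' 0 a' b')⁻¹) *
          (matJ K)⁻¹) * (matD t 0 a b)⁻¹ := by group
      _ = _ := by
        rw [h', matJ_conj_matLow, mul_inv_cancel_right, h]
        congr 1 <;> ring

theorem π_levi_conj {g : G} (hg : g ∈ F.levi) (u v : K) :
    ∃ u' v', F.π g * matLow u v * (F.π g)⁻¹ = matLow u' v' := by
  obtain ⟨p, q, r, s, h⟩ := F.π_levi_conj_linear hg
  exact ⟨_, _, h u v⟩

/-! ### The centralizer of y(1) in the Levi subgroup -/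

theorem T_mul_R (a : Kˣ) : F.T * F.R a⁻¹ = F.R a * F.T := by
  rw [← F.T_R_T, ← mul_assoc, ← mul_assoc, F.T_sq, one_mul]

/-- The element `T E₁₂(t) T`, which lies over the elementary matrix `E₃₂(t)`. -/
noncomputable def y (t : K) : G := F.T * F.x t * F.T

theorem T_y_T (t : K) : F.T * F.y t * F.T = F.x t := by
  calc _ = (F.T * F.T) * F.x t * (F.T * F.T) := by rw [y]; group
    _ = _ := by rw [F.T_sq, one_mul, mul_one]

theorem π_y (t : K) : F.π (F.y t) = matLow 0 t := by
  rw [y, map_mul, map_mul, F.π_T, F.π_x, matT_matD_matT, ← matD_eq_matLow]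
  simp

theorem y_inv (t : K) : (F.y t)⁻¹ = F.y (-t) := by
  simp only [y, mul_inv_rev, F.x_inv, F.T_inv, mul_assoc]

theorem y_conj_R (a : Kˣ) (t : K) : F.R a * F.y t * (F.R a)⁻¹ = F.y ((a⁻¹ : Kˣ) * t) := by
  have h1 : (F.R a⁻¹)⁻¹ * F.T = F.T * (F.R a)⁻¹ := by
    rw [← inv_inj, mul_inv_rev, mul_inv_rev, inv_inv, inv_inv, F.T_inv, F.T_mul_R]
  rw [y, y, ← F.R_conj_x]
  calc _ = F.R a * F.T * F.x t * (F.T * (F.R a)⁻¹) := by group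
    _ = _ := by rw [← h1, ← F.T_mul_R]; group

theorem W_eq : F.W = F.y 1 * F.R (-1) := by
  have h1 := F.T_mul_R (-1)
  rw [inv_neg, inv_one] at h1
  rw [Frame.W, F.S_eq, y, mul_assoc _ F.T, h1]
  group

theorem W_sq : F.W * F.W = 1 := by
  calc F.W * F.W = F.T * F.S * (F.T * F.T) * F.S * F.T := by rw [Frame.W]; group
    _ = F.T * (F.S * F.S) * F.T := by rw [F.T_sq]; group
    _ = 1 := by rw [F.S_sq, mul_one, F.T_sq]

/-- This torus element is T Z(b) T, while y(1) = T E₁₂(1) T; Z(b) commutes with E₁₂(1). -/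
theorem comm_y_h (b : Kˣ) : Commute (F.y 1) (F.h (b⁻¹ ^ 2) b) := by
  have h1 : F.h (b⁻¹ ^ 2) b = F.T * F.h b b * F.T := by
    rw [F.T_h_T, inv_pow, pow_two]
  have h2 : Commute (F.x 1) (F.h b b) := by
    rw [← F.Z_eq_h]; exact (F.comm_Z_x b 1).symm
  rw [h1, y]
  calc F.T * F.x 1 * F.T * (F.T * F.h b b * F.T)
      = F.T * F.x 1 * (F.T * F.T) * F.h b b * F.T := by group
    _ = F.T * (F.x 1 * F.h b b) * F.T := by rw [F.T_sq]; group
    _ = F.T * (F.h b b * F.x 1) * F.T := by rw [h2.eq]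
    _ = F.T * F.h b b * (F.T * F.T) * F.x 1 * F.T := by rw [F.T_sq]; group
    _ = _ := by group

/-- W inverts `x a` by relation (x), and so does R(-1); hence y(1) = W R(-1)⁻¹ centralizes it. -/
theorem comm_y_x_of_mem {a : Kˣ} (ha : a ∈ 𝓡) : Commute (F.y 1) (F.x a) := by
  have hW : F.W⁻¹ = F.W := inv_eq_of_mul_eq_one_left F.W_sq
  have h1 : F.W * F.x a * F.W⁻¹ = (F.x a)⁻¹ := by
    rw [eq_inv_iff_mul_eq_one, ← F.WE_sq a ha, hW, F.x_unit, pow_two]; group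
  have h2 : F.R (-1) * F.x a * (F.R (-1))⁻¹ = (F.x a)⁻¹ := by
    rw [F.R_conj_x, F.x_inv]; simp
  have h3 : F.y 1 = F.W * (F.R (-1))⁻¹ := by rw [F.W_eq]; group
  have h4 : (F.R (-1))⁻¹ * F.x a * F.R (-1) = (F.x a)⁻¹ := by
    rw [eq_inv_iff_mul_eq_one]
    calc _ = (F.R (-1))⁻¹ * (F.x a * (F.R (-1) * F.x a * (F.R (-1))⁻¹)) * F.R (-1) := by group
      _ = 1 := by rw [h2]; group
  rw [commute_iff_eq, ← mul_inv_eq_iff_eq_mul, h3]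
  calc _ = F.W * ((F.R (-1))⁻¹ * F.x a * F.R (-1)) * F.W⁻¹ := by group
    _ = (F.W * F.x a * F.W⁻¹)⁻¹ := by rw [h4]; group
    _ = _ := by rw [h1, inv_inv]

theorem exists_mul_cube (h𝓡 : IsCubeReps 𝓡) (t : Kˣ) : ∃ a ∈ 𝓡, ∃ b : Kˣ, t = a * b ^ 3 := by
  obtain ⟨a, ha, h⟩ := h𝓡.surjOn (Set.mem_univ (t : Kˣ ⧸ (powMonoidHom 3 : Kˣ →* Kˣ).range))
  obtain ⟨b, hb⟩ := QuotientGroup.eq.1 h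
  exact ⟨a, ha, b, by rw [← powMonoidHom_apply, hb, mul_inv_cancel_left]⟩

theorem comm_y_x (h𝓡 : IsCubeReps 𝓡) (t : K) : Commute (F.y 1) (F.x t) := by
  by_cases ht : t = 0
  · rw [ht, F.x_zero]; exact Commute.one_right _
  obtain ⟨c, rfl⟩ : ∃ a : Kˣ, (a : K) = t := ⟨Units.mk0 t ht, rfl⟩
  obtain ⟨a, ha, b, rfl⟩ := exists_mul_cube h𝓡 c
  -- The torus elements centralizing y(1) scale the parameter of `x` exactly by cubes, so
  -- representatives modulo cubes suffice.
  have h1 : F.x ((a * b ^ 3 : Kˣ) : K) =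
      F.h (b⁻¹⁻¹ ^ 2) b⁻¹ * F.x a * (F.h (b⁻¹⁻¹ ^ 2) b⁻¹)⁻¹ := by
    rw [F.h_mul_x, mul_inv_cancel_right]
    congr 1
    push_cast
    field_simp
  rw [h1]
  exact ((F.comm_y_h _).mul_right (F.comm_y_x_of_mem ha)).mul_right (F.comm_y_h _).inv_right

/-- The matrices in question are upper triangular on the GL₂ block with ab² = 1, so they are
products of `x t` and `h (b⁻¹ ^ 2) b`. -/
theorem comm_y_of_π (h𝓡 : IsCubeReps 𝓡) {g : G} (hg : g ∈ F.levi)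
    (h : Commute (F.π g) (matLow 0 1)) : Commute (F.y 1) g := by
  have h10 : F.π g 1 0 = 0 := by
    obtain ⟨-, h12, h20, -⟩ := F.π_levi hg
    have e := congrArg (fun M : SL(3, K) => M 2 0) h.eq
    simpa [coe_matLow, coe_mul_apply] using e
  obtain ⟨t, a, b, rfl⟩ := F.mem_borel_of_mem_levi hg h10
  rw [F.π_x_mul_h, commute_iff_eq, matD_conj_matLow, mul_left_inj, matLow_inj] at h
  have ha : a = b⁻¹ ^ 2 := by
    have h2 := h.2
    rw [mul_zero, zero_div, sub_zero] at h2
    field_simp at h2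
    rw [inv_pow, eq_inv_iff_mul_eq_one]
    ext
    push_cast
    simpa [mul_comm] using h2.symm
  rw [ha]
  exact (F.comm_y_x h𝓡 t).mul_right (F.comm_y_h b)

/-! ### Root elements and their products -/

/-- The conjugates of `y 1` under the subgroup `levi`; they lie over the nontrivial matrices
`matLow u v`. -/
def IsRoot (g : G) : Prop := ∃ l ∈ F.levi, g = l * F.y 1 * l⁻¹

variable {F}

theorem IsRoot.conj {g : G} (hg : F.IsRoot g) {l : G} (hl : l ∈ F.levi) :
    F.IsRoot (l * g * l⁻¹) := by
  obtain ⟨k, hk, rfl⟩ := hg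
  exact ⟨l * k, mul_mem hl hk, by group⟩

/-- Orbit-stabilizer: two conjugators giving the same image differ by an element whose image fixes
that of y(1), and this element already commutes with y(1) in G. -/
theorem IsRoot.ext (h𝓡 : IsCubeReps 𝓡) {g g' : G} (hg : F.IsRoot g) (hg' : F.IsRoot g')
    (h : F.π g = F.π g') : g = g' := by
  obtain ⟨k, hk, rfl⟩ := hg
  obtain ⟨l, hl, rfl⟩ := hg'
  have h1 := F.comm_y_of_π h𝓡 (mul_mem (inv_mem hl) hk) (by
    simp only [map_mul, map_inv, F.π_y] at h ⊢
    rw [commute_iff_eq, ← mul_inv_eq_iff_eq_mul]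
    calc _ = (F.π l)⁻¹ * (F.π k * matLow 0 1 * (F.π k)⁻¹) * F.π l := by group
      _ = _ := by rw [h]; group)
  calc k * F.y 1 * k⁻¹ = l * (l⁻¹ * k * F.y 1) * k⁻¹ := by group
    _ = l * (F.y 1 * (l⁻¹ * k)) * k⁻¹ := by rw [h1.eq]
    _ = _ := by group

theorem IsRoot.exists_π {g : G} (hg : F.IsRoot g) :
    ∃ u v, (u ≠ 0 ∨ v ≠ 0) ∧ F.π g = matLow u v := by
  obtain ⟨k, hk, rfl⟩ := hg
  obtain ⟨u, v, h⟩ := F.π_levi_conj hk 0 1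
  refine ⟨u, v, ?_, by rw [map_mul, map_mul, map_inv, F.π_y, h]⟩
  by_contra! h0
  rw [h0.1, h0.2, matLow_zero, conj_eq_one_iff, matLow_eq_one] at h
  exact one_ne_zero h.2

variable (F)

theorem isRoot_y (v : Kˣ) : F.IsRoot (F.y v) :=
  ⟨F.R v⁻¹, F.R_mem_levi _, by rw [F.y_conj_R, inv_inv, mul_one]⟩

theorem exists_isRoot {u v : K} (h : u ≠ 0 ∨ v ≠ 0) : ∃ g, F.IsRoot g ∧ F.π g = matLow u v := by
  by_cases hu : u = 0
  · obtain ⟨w, rfl⟩ : ∃ a : Kˣ, (a : K) = v := ⟨Units.mk0 v (by simpa [hu] using h), rfl⟩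
    exact ⟨_, F.isRoot_y w, by rw [hu, F.π_y]⟩
  · obtain ⟨w, rfl⟩ : ∃ a : Kˣ, (a : K) = u := ⟨Units.mk0 u hu, rfl⟩
    refine ⟨_, ((F.isRoot_y w).conj F.J_mem_levi).conj
      (F.borel_le_levi (F.x_mem_borel (-(v / w)))), ?_⟩
    simp only [map_mul, map_inv, F.π_y, F.π_J, F.π_x]
    rw [matJ_conj_matLow, mul_inv_cancel_right, matD_conj_matLow, mul_inv_cancel_right,
      matLow_inj]
    constructor <;> simp

variable {F}

theorem IsRoot.inv {g : G} (hg : F.IsRoot g) : F.IsRoot g⁻¹ := by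
  obtain ⟨k, hk, rfl⟩ := hg
  have h := (F.isRoot_y (-1)).conj hk
  have e : F.y ((-1 : Kˣ) : K) = (F.y 1)⁻¹ := by rw [F.y_inv]; simp
  rw [e] at h
  simpa [mul_assoc] using h

/-- Substituting W = y(1) R(-1) turns relation (xi) into y(1) · gy(1)g⁻¹ = ρy(1)ρ⁻¹ · l with l in
the Levi subgroup. -/
theorem isRoot_y_mul_of_mem {a : Kˣ} (ha : a ∈ 𝓡) :
    F.IsRoot (F.y 1 * (F.R (-1) * F.J * F.R a * F.y 1 * (F.R (-1) * F.J * F.R a)⁻¹)) := by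
  set g := F.R (-1) * F.J * F.R a with hg
  set ρ := F.E (-a) * F.J * F.R a with hρ
  set μ := F.E (-(a ^ 2)⁻¹) * F.J * F.E (a ^ 2) * F.R a ^ 4 * (F.Z a ^ 2)⁻¹ with hμ
  have hgL : g ∈ F.levi :=
    mul_mem (mul_mem (F.R_mem_levi _) F.J_mem_levi) (F.R_mem_levi _)
  have hρL : ρ ∈ F.levi :=
    mul_mem (mul_mem (F.E_mem_levi _) F.J_mem_levi) (F.R_mem_levi _)
  have hμL : μ ∈ F.levi :=
    mul_mem (mul_mem (mul_mem (mul_mem (F.E_mem_levi _) F.J_mem_levi) (F.E_mem_levi _))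
      (pow_mem (F.R_mem_levi _) _)) (inv_mem (pow_mem (F.Z_mem_levi _) _))
  have hrel : (ρ * F.y 1 * ρ⁻¹)⁻¹ * (F.y 1 * (g * F.y 1 * g⁻¹)) =
      ρ * F.R (-1) * μ * (F.R (-1))⁻¹ * g⁻¹ := by
    have h1 := F.WJRW a ha
    rw [← hρ, ← hμ, F.W_eq] at h1
    have h2 : F.y 1 * F.R (-1) * F.J * F.R a * (F.y 1 * F.R (-1)) =
        F.y 1 * (g * F.y 1 * g⁻¹) * g * F.R (-1) := by rw [hg]; group
    rw [h2] at h1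
    calc _ = (ρ * F.y 1 * ρ⁻¹)⁻¹ * (F.y 1 * (g * F.y 1 * g⁻¹) * g * F.R (-1)) *
          (F.R (-1))⁻¹ * g⁻¹ := by group
      _ = _ := by rw [h1]; group
  set l := ρ * F.R (-1) * μ * (F.R (-1))⁻¹ * g⁻¹ with hl
  have hlL : l ∈ F.levi := mul_mem (mul_mem (mul_mem (mul_mem hρL (F.R_mem_levi _)) hμL)
    (inv_mem (F.R_mem_levi _))) (inv_mem hgL)
  -- The image of `l` is both a product of unipotents `matLow` and block diagonal, hence trivial;
  -- `π` is injective on the Levi subgroup.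
  have hl1 : l = 1 := by
    refine F.eq_one_of_mem_levi hlL ?_
    obtain ⟨u, v, h1⟩ := F.π_levi_conj hρL 0 (-1)
    obtain ⟨u', v', h2⟩ := F.π_levi_conj hgL 0 1
    obtain ⟨-, -, h20, h21⟩ := F.π_levi hlL
    have h3 : F.π l = matLow (u + (0 + u')) (v + (1 + v')) := by
      rw [← matLow_mul, ← matLow_mul, ← h1, ← h2, ← F.π_y, ← F.π_y, ← F.y_inv, ← hrel]
      simp only [map_mul, map_inv]
      group
    rw [h3] at h20 h21 ⊢
    rw [matLow_eq_one]
    exact ⟨by simpa [coe_matLow] using h20, by simpa [coe_matLow] using h21⟩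
  rw [hl1, inv_mul_eq_one] at hrel
  exact ⟨ρ, hρL, hrel.symm⟩

theorem IsRoot.y_mul (h𝓡 : IsCubeReps 𝓡) {g : G} (hg : F.IsRoot g) {u v : K} (hu : u ≠ 0)
    (h : F.π g = matLow u v) : F.IsRoot (F.y 1 * g) := by
  obtain ⟨c, rfl⟩ : ∃ a : Kˣ, (a : K) = u := ⟨Units.mk0 u hu, rfl⟩
  obtain ⟨a, ha, b, hab⟩ := exists_mul_cube h𝓡 c⁻¹
  -- Chosen to commute with y(1) and to move the vector (c, v) to (a⁻¹, 0), the vector of the root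
  -- in relation (xi).
  set l := F.x (v / (b ^ 3 * c)) * F.h (b⁻¹ ^ 2) b with hl
  have hlL : l ∈ F.levi :=
    F.borel_le_levi (mul_mem (F.x_mem_borel _) (F.h_mem_borel _ _))
  have hlc : Commute (F.y 1) l := (F.comm_y_x h𝓡 _).mul_right (F.comm_y_h b)
  have hr := F.isRoot_y_mul_of_mem ha
  have e : l * g * l⁻¹ = F.R (-1) * F.J * F.R a * F.y 1 * (F.R (-1) * F.J * F.R a)⁻¹ := by
    refine (hg.conj hlL).ext h𝓡 ⟨_, mul_mem (mul_mem (F.R_mem_levi _) F.J_mem_levi)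
      (F.R_mem_levi _), rfl⟩ ?_
    have e1 : F.π (l * g * l⁻¹) = matLow (a : K)⁻¹ 0 := by
      rw [map_mul, map_mul, map_inv, h, hl, F.π_x_mul_h, matD_conj_matLow, mul_inv_cancel_right,
        matLow_inj]
      have hc : (c : K) = (a : K)⁻¹ * ((b : K) ^ 3)⁻¹ := by
        rw [← inv_inv c, hab]; push_cast; rw [mul_inv_rev, mul_comm]
      constructor
      · rw [hc]; push_cast; field_simp
      · push_cast; field_simp; ring
    have e2 : F.π (F.R (-1) * F.J * F.R a * F.y 1 * (F.R (-1) * F.J * F.R a)⁻¹) =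
        matLow (a : K)⁻¹ 0 := by
      rw [map_mul, map_inv, mul_inv_eq_iff_eq_mul]
      simp only [map_mul, F.π_R, F.π_J, F.π_y, matR_eq]
      rw [mul_assoc, matD_conj_matLow, ← mul_assoc, mul_assoc (matD _ _ _ _), matJ_conj_matLow,
        ← mul_assoc, matD_conj_matLow]
      simp only [mul_assoc]
      congr 1
      rw [matLow_inj]
      constructor <;> simp
    rw [e1, e2]
  rw [← e] at hr
  have := hr.conj (inv_mem hlL)
  have e3 : l⁻¹ * (F.y 1 * (l * g * l⁻¹)) * l⁻¹⁻¹ = l⁻¹ * (F.y 1 * l) * g := by group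
  rwa [e3, hlc.eq, inv_mul_cancel_left] at this

theorem IsRoot.mul_of_ne (h𝓡 : IsCubeReps 𝓡) {g g' : G} (hg : F.IsRoot g) (hg' : F.IsRoot g')
    {u v u' v' : K} (h : F.π g = matLow u v) (h' : F.π g' = matLow u' v')
    (hne : u * v' ≠ v * u') : F.IsRoot (g * g') := by
  obtain ⟨k, hk, rfl⟩ := hg
  obtain ⟨w, z, hwz⟩ := F.π_levi_conj (inv_mem hk) u' v'
  have hr := hg'.conj (inv_mem hk)
  have hπ : F.π (k⁻¹ * g' * k⁻¹⁻¹) = matLow w z := by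
    rw [map_mul, map_mul, map_inv F.π k⁻¹, h', hwz]
  -- If w = 0, both vectors are images of multiples of (0, 1) under the same linear map, hence
  -- dependent.
  have hw : w ≠ 0 := by
    rintro rfl
    apply hne
    obtain ⟨p, q, r, s, hl⟩ := F.π_levi_conj_linear hk
    have h1 := hl 0 1
    rw [← F.π_y, ← map_inv, ← map_mul, ← map_mul, h, matLow_inj] at h1
    have h2 := hl 0 z
    rw [← hπ, ← map_inv, ← map_mul, ← map_mul, inv_inv, ← mul_assoc, ← mul_assoc,
      mul_inv_cancel, one_mul, mul_inv_cancel_right, h', matLow_inj] at h2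
    rw [h1.1, h1.2, h2.1, h2.2]
    ring
  have := (hr.y_mul h𝓡 hw hπ).conj hk
  have e : k * (F.y 1 * (k⁻¹ * g' * k⁻¹⁻¹)) * k⁻¹ = k * F.y 1 * k⁻¹ * g' := by group
  rwa [e] at this

variable (F)

/-- The abelian subgroup lying over the matrices `matLow u v`. -/
def unipotent (h𝓡 : IsCubeReps 𝓡) : Subgroup G where
  carrier := {g | g = 1 ∨ F.IsRoot g}
  one_mem' := Or.inl rfl
  inv_mem' := by
    rintro _ (rfl | h)
    · exact Or.inl inv_one
    · exact Or.inr h.inv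
  mul_mem' := by
    rintro g g' (rfl | hg) (rfl | hg')
    · exact Or.inl (one_mul 1)
    · exact Or.inr (by rwa [one_mul])
    · exact Or.inr (by rwa [mul_one])
    obtain ⟨u, v, h0, h⟩ := hg.exists_π
    obtain ⟨u', v', h0', h'⟩ := hg'.exists_π
    by_cases hne : u * v' = v * u'
    · by_cases hsum : u + u' = 0 ∧ v + v' = 0
      · left
        rw [← eq_inv_iff_mul_eq_one]
        refine hg.ext h𝓡 hg'.inv ?_
        rw [map_inv, eq_inv_iff_mul_eq_one, h, h', matLow_mul, matLow_eq_one]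
        exact hsum
      right
      -- For dependent vectors with nonzero sum, an auxiliary root k off their line gives gg' =
      -- (g(g'k⁻¹))k, where each multiplication is of independent roots.
      obtain ⟨p, q, hpq⟩ : ∃ p q, u * q ≠ v * p := by
        rcases h0 with h0 | h0
        · exact ⟨0, 1, by simpa using h0⟩
        · exact ⟨1, 0, by simpa using h0.symm⟩
      have hpq' : u' * q ≠ v' * p := by
        intro e
        apply hpq
        rcases h0' with h0' | h0'
        · apply mul_left_cancel₀ h0'
          linear_combination u * e + p * hne
        · apply mul_left_cancel₀ h0'
          linear_combination v * e + q * hne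
      have hpq0 : p ≠ 0 ∨ q ≠ 0 := by
        by_contra! e
        simp [e] at hpq
      obtain ⟨k, hk, hkπ⟩ := F.exists_isRoot hpq0
      have hkπ' : F.π k⁻¹ = matLow (-p) (-q) := by
        rw [map_inv, inv_eq_iff_mul_eq_one, hkπ, matLow_mul, add_neg_cancel, add_neg_cancel,
          matLow_zero]
      have r1 := hg'.mul_of_ne h𝓡 hk.inv h' hkπ' (by
        intro e; apply hpq'; linear_combination -e)
      have r1π : F.π (g' * k⁻¹) = matLow (u' + -p) (v' + -q) := by
        rw [map_mul, h', hkπ', matLow_mul]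
      have r2 := hg.mul_of_ne h𝓡 r1 h r1π (by
        intro e; apply hpq; linear_combination -e + hne)
      have r2π : F.π (g * (g' * k⁻¹)) = matLow (u + (u' + -p)) (v + (v' + -q)) := by
        rw [map_mul, h, r1π, matLow_mul]
      have r3 := r2.mul_of_ne h𝓡 hk r2π hkπ (by
        intro e
        have e1 : (u + u') * q = (v + v') * p := by linear_combination e
        have e2 : (u + u') * (u * q - v * p) = 0 := by linear_combination u * e1 + p * hne
        have e3 : (v + v') * (u * q - v * p) = 0 := by linear_combination v * e1 + q * hne
        have e4 := sub_ne_zero.2 hpq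
        exact hsum ⟨(mul_eq_zero.1 e2).resolve_right e4, (mul_eq_zero.1 e3).resolve_right e4⟩)
      simpa [mul_assoc] using r3
    · exact Or.inr (hg.mul_of_ne h𝓡 hg' h h' hne)

/-! ### The parabolic subgroup and the double coset of T -/

/-- The subgroup lying over the stabilizer of a point of the projective plane. -/
def parabolic (h𝓡 : IsCubeReps 𝓡) : Subgroup G where
  carrier := {g | ∃ n ∈ F.unipotent h𝓡, ∃ l ∈ F.levi, g = n * l}
  one_mem' := ⟨1, one_mem _, 1, one_mem _, (one_mul 1).symm⟩
  inv_mem' := by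
    rintro _ ⟨n, hn, l, hl, rfl⟩
    refine ⟨l⁻¹ * n⁻¹ * l⁻¹⁻¹, ?_, l⁻¹, inv_mem hl, by group⟩
    rcases inv_mem hn with h | h
    · rw [h]; exact Or.inl (by group)
    · exact Or.inr (h.conj (inv_mem hl))
  mul_mem' := by
    rintro _ _ ⟨n, hn, l, hl, rfl⟩ ⟨n', hn', l', hl', rfl⟩
    refine ⟨n * (l * n' * l⁻¹), mul_mem hn ?_, l * l', mul_mem hl hl', by group⟩
    rcases hn' with h | h
    · rw [h]; exact Or.inl (by group)
    · exact Or.inr (h.conj hl)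

theorem levi_le_parabolic (h𝓡 : IsCubeReps 𝓡) : F.levi ≤ F.parabolic h𝓡 := fun l hl =>
  ⟨1, one_mem _, l, hl, (one_mul l).symm⟩

theorem y_mem_parabolic (h𝓡 : IsCubeReps 𝓡) (t : K) : F.y t ∈ F.parabolic h𝓡 := by
  refine ⟨F.y t, ?_, 1, one_mem _, (mul_one _).symm⟩
  by_cases ht : t = 0
  · left
    rw [ht, y, F.x_zero, mul_one, F.T_sq]
  · exact Or.inr (F.isRoot_y (Units.mk0 t ht))

theorem W_mem_parabolic (h𝓡 : IsCubeReps 𝓡) : F.W ∈ F.parabolic h𝓡 := by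
  rw [F.W_eq]
  exact mul_mem (F.y_mem_parabolic h𝓡 1) (F.levi_le_parabolic h𝓡 (F.R_mem_levi _))

theorem exists_π_unipotent {h𝓡 : IsCubeReps 𝓡} {n : G} (hn : n ∈ F.unipotent h𝓡) :
    ∃ u v, F.π n = matLow u v := by
  rcases hn with rfl | hn
  · exact ⟨0, 0, by rw [map_one, matLow_zero]⟩
  · obtain ⟨u, v, -, h⟩ := hn.exists_π
    exact ⟨u, v, h⟩

theorem eq_one_of_mem_unipotent {h𝓡 : IsCubeReps 𝓡} {n : G} (hn : n ∈ F.unipotent h𝓡)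
    (h : F.π n = 1) : n = 1 := by
  rcases hn with rfl | hn
  · rfl
  · obtain ⟨u, v, h0, h'⟩ := hn.exists_π
    rw [h', matLow_eq_one] at h
    simp [h] at h0

theorem π_parabolic {h𝓡 : IsCubeReps 𝓡} {g : G} (hg : g ∈ F.parabolic h𝓡) :
    F.π g 0 2 = 0 ∧ F.π g 1 2 = 0 := by
  obtain ⟨n, hn, l, hl, rfl⟩ := hg
  obtain ⟨u, v, h⟩ := F.exists_π_unipotent hn
  obtain ⟨h02, h12, -, -⟩ := F.π_levi hl
  rw [map_mul, h]
  simp [coe_matLow, coe_mul_apply,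
    h02, h12]

/-- The images of N and L meet trivially, and `π` is injective on each. -/
theorem eq_one_of_mem_parabolic {h𝓡 : IsCubeReps 𝓡} {g : G} (hg : g ∈ F.parabolic h𝓡)
    (h1 : F.π g = 1) : g = 1 := by
  obtain ⟨n, hn, l, hl, rfl⟩ := hg
  obtain ⟨u, v, h⟩ := F.exists_π_unipotent hn
  obtain ⟨-, -, h20, h21⟩ := F.π_levi hl
  have h2 : F.π l = matLow (-u) (-v) := by
    rw [map_mul, h] at h1
    rw [eq_inv_of_mul_eq_one_right h1, inv_eq_iff_mul_eq_one, matLow_mul, add_neg_cancel,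
      add_neg_cancel, matLow_zero]
  have hu : u = 0 := by simpa [h2, coe_matLow] using h20
  have hv : v = 0 := by simpa [h2, coe_matLow] using h21
  subst hu hv
  rw [neg_zero, matLow_zero] at h2
  rw [matLow_zero] at h
  rw [F.eq_one_of_mem_unipotent hn h, F.eq_one_of_mem_levi hl h2, mul_one]

theorem parabolic_injOn {h𝓡 : IsCubeReps 𝓡} {g g' : G} (hg : g ∈ F.parabolic h𝓡)
    (hg' : g' ∈ F.parabolic h𝓡) (h : F.π g = F.π g') : g = g' := by
  rw [← mul_inv_eq_one]
  refine F.eq_one_of_mem_parabolic (mul_mem hg (inv_mem hg')) ?_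
  rw [map_mul, map_inv, h, mul_inv_cancel]

/-- The element lying over the matrix `matD t v a b`. -/
noncomputable def d (t v : K) (a b : Kˣ) : G := F.x t * F.y v * F.h a b

theorem π_d (t v : K) (a b : Kˣ) : F.π (F.d t v a b) = matD t v a b := by
  rw [d, map_mul, map_mul, F.π_x, F.π_y, F.π_h, ← matD_eq_matLow, matD_mul, matD_mul]
  simp

theorem d_mem_parabolic (h𝓡 : IsCubeReps 𝓡) (t v : K) (a b : Kˣ) :
    F.d t v a b ∈ F.parabolic h𝓡 :=
  mul_mem (mul_mem (F.levi_le_parabolic h𝓡 (F.borel_le_levi (F.x_mem_borel t)))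
    (F.y_mem_parabolic h𝓡 v)) (F.levi_le_parabolic h𝓡 (F.borel_le_levi (F.h_mem_borel a b)))

theorem T_d_T_mem_parabolic (h𝓡 : IsCubeReps 𝓡) (t v : K) (a b : Kˣ) :
    F.T * F.d t v a b * F.T ∈ F.parabolic h𝓡 := by
  have e : F.T * F.d t v a b * F.T = F.y t * F.x v * F.h (a * b)⁻¹ b := by
    rw [← F.T_y_T v, ← F.T_h_T, y.eq_1 F t, d]
    calc _ = F.T * F.x t * (F.T * F.T) * (F.T * F.T)⁻¹ * F.y v * (F.T * F.T) * (F.T * F.T)⁻¹ *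
        F.h a b * F.T := by group
      _ = F.T * F.x t * (F.T * F.T) * F.y v * (F.T * F.T) * F.h a b * F.T := by
        simp only [F.T_sq, inv_one, mul_one]
      _ = _ := by group
  rw [e]
  exact mul_mem (mul_mem (F.y_mem_parabolic h𝓡 t)
    (F.levi_le_parabolic h𝓡 (F.borel_le_levi (F.x_mem_borel v))))
    (F.levi_le_parabolic h𝓡 (F.borel_le_levi (F.h_mem_borel _ b)))

/-- Since TWT = S, the left side is (TJT) S (TJT); the braid relations for T, J and for J, S do the
rest. -/
theorem T_J_W_J_T : F.T * (F.J * F.W * F.J) * F.T = F.J * F.W * F.J * F.T * (F.J * F.W * F.J) := by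
  have hT := F.T_inv
  have hJ := F.J_inv
  have h1 : F.T * F.J = F.J * F.T * F.J * F.T := by
    rw [← F.T_J_T]
    simp only [mul_assoc, F.T_sq, mul_one]
  have h2 : F.J * F.T = F.T * F.J * F.T * F.J := by
    rw [F.T_J_T]
    simp only [mul_assoc, F.J_sq, mul_one]
  have h3 : F.T * F.W * F.T = F.S := by
    calc _ = (F.T * F.T) * F.S * (F.T * F.T) := by rw [Frame.W]; group
      _ = F.S := by rw [F.T_sq, one_mul, mul_one]
  have h4 : F.T * F.S = F.W * F.T := by
    rw [Frame.W, mul_assoc, F.T_sq, mul_one]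
  have h5 : F.S * F.T = F.T * F.W := by
    rw [Frame.W, ← mul_assoc, ← mul_assoc, F.T_sq, one_mul]
  calc F.T * (F.J * F.W * F.J) * F.T = (F.T * F.J) * F.W * (F.J * F.T) := by group
    _ = (F.J * F.T * F.J * F.T) * F.W * (F.T * F.J * F.T * F.J) := by rw [← h1, ← h2]
    _ = F.J * F.T * F.J * (F.T * F.W * F.T) * F.J * F.T * F.J := by group
    _ = F.J * F.T * (F.J * F.S * F.J) * F.T * F.J := by rw [h3]; group
    _ = F.J * (F.T * F.S) * F.J * (F.S * F.T) * F.J := by rw [F.J_S_J]; group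
    _ = F.J * F.W * (F.T * F.J * F.T) * F.W * F.J := by rw [h4, h5]; group
    _ = _ := by rw [F.T_J_T]; group

theorem T_conj_of_double_coset {h𝓡 : IsCubeReps 𝓡} {g k k' m : G}
    (hk : F.T * k * F.T ∈ F.parabolic h𝓡) (hk' : F.T * k' * F.T ∈ F.parabolic h𝓡)
    (hm : m ∈ F.parabolic h𝓡) (h : F.T * g * F.T = m * F.T * m) :
    ∃ q ∈ F.parabolic h𝓡, ∃ r ∈ F.parabolic h𝓡,
      F.T * (k * g * k') * F.T = q * F.T * r := by
  refine ⟨F.T * k * F.T * m, mul_mem hk hm, m * (F.T * k' * F.T), mul_mem hm hk', ?_⟩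
  have hT : (F.T * F.T)⁻¹ = 1 := by rw [F.T_sq, inv_one]
  calc F.T * (k * g * k') * F.T
      = F.T * k * F.T * (F.T * F.T)⁻¹ * (F.T * g * F.T) * (F.T * F.T)⁻¹ * (F.T * k' * F.T) := by
        group
    _ = _ := by rw [hT, h]; group

/-- The decomposition of the matrix `π p` lifts to `p` because `π` is injective on P. Conjugation by
T keeps the factors `d` in P, and each middle factor m = J, JWJ satisfies TmT = mTm. -/
theorem T_parabolic_T {h𝓡 : IsCubeReps 𝓡} (p : G) (hp : p ∈ F.parabolic h𝓡) :
    F.T * p * F.T ∈ F.parabolic h𝓡 ∨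
      ∃ q ∈ F.parabolic h𝓡, ∃ r ∈ F.parabolic h𝓡, F.T * p * F.T = q * F.T * r := by
  obtain ⟨h02, h12⟩ := F.π_parabolic hp
  have hJ := F.levi_le_parabolic h𝓡 F.J_mem_levi
  have hJWJ := mul_mem (mul_mem hJ (F.W_mem_parabolic h𝓡)) hJ
  have hd := F.d_mem_parabolic h𝓡
  have hTd := F.T_d_T_mem_parabolic h𝓡
  have πW : F.π F.W = matW K := by
    rw [Frame.W, map_mul, map_mul, F.π_T, F.π_S, matW_eq]
  obtain ⟨t, v, a, b, t', v', a', b', h | h | h⟩ := exists_double_coset h02 h12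
  · left
    have e : p = F.d t v a b * F.d t' v' a' b' :=
      F.parabolic_injOn hp (mul_mem (hd ..) (hd ..)) (by rw [h, map_mul, F.π_d, F.π_d])
    have e' : F.T * p * F.T =
        (F.T * F.d t v a b * F.T) * (F.T * F.T)⁻¹ * (F.T * F.d t' v' a' b' * F.T) := by
      rw [e]; group
    rw [e', F.T_sq, inv_one, mul_one]
    exact mul_mem (hTd ..) (hTd ..)
  · right
    have e : p = F.d t v a b * F.J * F.d t' v' a' b' :=
      F.parabolic_injOn hp (mul_mem (mul_mem (hd ..) hJ) (hd ..)) (by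
        rw [h, map_mul, map_mul, F.π_d, F.π_d, F.π_J])
    rw [e]
    exact F.T_conj_of_double_coset (hTd ..) (hTd ..) hJ F.T_J_T
  · right
    have e : p = F.d t v a b * (F.J * F.W * F.J) * F.d t' v' a' b' :=
      F.parabolic_injOn hp (mul_mem (mul_mem (hd ..) hJWJ) (hd ..)) (by
        rw [h]
        simp only [map_mul, F.π_d, F.π_J, πW])
    rw [e]
    exact F.T_conj_of_double_coset (hTd ..) (hTd ..) hJWJ F.T_J_W_J_T

theorem π_injective (h𝓡 : IsCubeReps 𝓡)
    (hgen : ∀ H : Subgroup G, (∀ a, F.R a ∈ H) → F.S ∈ H → F.J ∈ H → F.T ∈ H → H = ⊤) :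
    Function.Injective F.π := by
  have hle := (F.levi_le_parabolic h𝓡).trans (le_doubleCosetSubgroup F.T_sq F.T_parabolic_T)
  have htop := hgen (doubleCosetSubgroup _ F.T F.T_sq F.T_parabolic_T)
    (fun a => hle (F.R_mem_levi a)) (hle (F.borel_le_levi F.S_mem_borel)) (hle F.J_mem_levi)
    (mem_doubleCosetSubgroup _ _)
  refine (injective_iff_map_eq_one _).2 fun g hg => ?_
  refine eq_one_of_mem_doubleCosetSubgroup F.π F.T_sq F.T_parabolic_T
    (fun p hp => F.eq_one_of_mem_parabolic hp) (fun p hp e => ?_)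
    (htop ▸ Subgroup.mem_top g) hg
  have h := (F.π_parabolic hp).1
  rw [e, F.π_T] at h
  simp [coe_matT] at h

theorem π_surjective : Function.Surjective F.π := by
  rw [← MonoidHom.range_eq_top]
  exact eq_top_of_mem (fun t v a b => ⟨_, F.π_d t v a b⟩) ⟨_, F.π_J⟩ ⟨_, F.π_T⟩

end Realization

/-! ### The presented group as a realization -/

section Presentation

variable {K : Type*} [Field K]

theorem matD_pow (a b : Kˣ) (n : ℕ) : matD (0 : K) 0 a b ^ n = matD 0 0 (a ^ n) (b ^ n) := by
  induction n with
  | zero => simp [matD_one]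
  | succ n ih => rw [pow_succ, ih, matD_mul]; simp [pow_succ]

theorem lift_wR (a : Kˣ) : FreeGroup.lift Gen.toSL (wR a) = matR a := by
  unfold wR
  split_ifs with h
  · rw [h, matR_eq, matD_one, map_one]
  · rw [FreeGroup.lift_apply_of, Gen.toSL]

theorem lift_wS : FreeGroup.lift Gen.toSL (wS K) = matS K := by
  rw [wS, FreeGroup.lift_apply_of, Gen.toSL]

theorem lift_wJ : FreeGroup.lift Gen.toSL (wJ K) = matJ K := by
  rw [wJ, FreeGroup.lift_apply_of, Gen.toSL]

theorem lift_wT : FreeGroup.lift Gen.toSL (wT K) = matT K := by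
  rw [wT, FreeGroup.lift_apply_of, Gen.toSL]

theorem matJ_matR_sq (a : Kˣ) : (matJ K * matR a) ^ 2 = matD 0 0 a a := by
  calc _ = matJ K * matR a * matJ K * matR a := by rw [pow_two]; group
    _ = _ := by rw [matR_eq, matJ_matD_matJ, matD_mul]; simp

theorem lift_wZ (a : Kˣ) : FreeGroup.lift Gen.toSL (wZ a) = matD 0 0 a a := by
  unfold wZ
  split_ifs with h
  · rw [h, matD_one, map_one]
  · rw [map_pow, map_mul, lift_wJ, lift_wR, matJ_matR_sq]

theorem lift_wE (a : Kˣ) : FreeGroup.lift Gen.toSL (wE a) = matD (a : K) 0 1 1 := by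
  simp only [wE, map_mul, map_inv, lift_wR, lift_wS, matR_eq, matS_eq, matD_mul, matD_inv]
  simp

theorem lift_wW : FreeGroup.lift Gen.toSL (wW K) = matW K := by
  simp only [wW, map_mul, lift_wT, lift_wS, matW_eq]

theorem lift_eq_of_rel {𝓡 : Set Kˣ} {u v : FreeGroup (Gen K)} (h : Rel 𝓡 u v) :
    FreeGroup.lift Gen.toSL u = FreeGroup.lift Gen.toSL v := by
  cases h with
  | S_sq => simp [lift_wS, pow_two, matS_eq, matD_mul, matD_one]
  | J_sq => simp [lift_wJ, pow_two, matJ_sq]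
  | T_sq => simp [lift_wT, pow_two, matT_sq]
  | R_mul a b => simp [lift_wR, matR_eq, matD_mul]
  | Z_mul a b => simp [lift_wZ, matD_mul]
  | comm_R_Z a b =>
    rw [map_commutatorElement, lift_wR, lift_wZ, map_one, commutatorElement_eq_one_iff_mul_comm,
      matR_eq, matD_mul, matD_mul]
    simp [mul_comm]
  | comm_S_Z a =>
    rw [map_commutatorElement, lift_wS, lift_wZ, map_one, commutatorElement_eq_one_iff_mul_comm,
      matS_eq, matD_mul, matD_mul]
    simp
  | comm_S_R a ha =>
    rw [map_commutatorElement, lift_wS, lift_wR, lift_wE, commutatorElement_def, matS_eq, matR_eq]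
    simp only [matD_mul, matD_inv]
    simp [oneSub, sub_eq_add_neg]
  | JS_cube => simp [lift_wS, lift_wJ, matJ_matS_cube]
  | TJ_cube => simp [lift_wT, lift_wJ, matT_matJ_cube]
  | TR_sq a =>
    rw [map_pow, map_mul, lift_wT, lift_wR, map_one, pow_two, ← mul_assoc, matR_eq,
      matT_matD_matT, matD_mul, ← matD_one]
    simp
  | comm_Z_T a =>
    have hT : (matT K)⁻¹ = matT K := inv_eq_of_mul_eq_one_left matT_sq
    rw [map_commutatorElement, lift_wT, lift_wZ, map_pow, lift_wR, commutatorElement_def, hT,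
      matD_inv, mul_assoc, mul_assoc, ← mul_assoc (matT K), matT_matD_matT, matD_mul, matR_eq,
      matD_pow]
    simp [pow_succ, mul_assoc]
  | WE_sq a =>
    rw [map_pow, map_mul, lift_wW, lift_wE, map_one, matW_eq_matD, pow_two]
    simp only [matD_mul]
    rw [← matD_one]
    simp
  | WJRW a =>
    have hD : matD (0 : K) 0 a 1 ^ 4 * (matD 0 0 a a ^ 2)⁻¹ = matD 0 0 (a ^ 2) (a ^ 2)⁻¹ := by
      rw [matD_pow, matD_pow, matD_inv, matD_mul]
      congr 1 <;> simp [pow_succ, mul_assoc]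
    have h := matW_matJ_matR_matW a
    rw [← hD] at h
    simp only [wRho, wLambda, map_mul, map_pow, map_inv, lift_wW, lift_wJ, lift_wR, lift_wE,
      lift_wZ]
    rw [h, matR_eq]
    push_cast
    simp only [mul_assoc]

/-- The group given by the presentation. -/
abbrev PresGroup (𝓡 : Set Kˣ) : Type _ :=
  FreeGroup (Gen K) ⧸ Subgroup.normalClosure (relators 𝓡)

theorem normalClosure_relators_le_ker (𝓡 : Set Kˣ) :
    Subgroup.normalClosure (relators 𝓡) ≤ (FreeGroup.lift (Gen.toSL (K := K))).ker := by
  refine Subgroup.normalClosure_le_normal ?_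
  rintro _ ⟨u, v, h, rfl⟩
  rw [SetLike.mem_coe, MonoidHom.mem_ker, map_mul, map_inv, lift_eq_of_rel h, mul_inv_cancel]

/-- The quotient map from words to the presented group. -/
def PresGroup.mk (𝓡 : Set Kˣ) : FreeGroup (Gen K) →* PresGroup 𝓡 := QuotientGroup.mk' _

theorem PresGroup.mk_eq_of_rel {𝓡 : Set Kˣ} {u v : FreeGroup (Gen K)} (h : Rel 𝓡 u v) :
    PresGroup.mk 𝓡 u = PresGroup.mk 𝓡 v := by
  rw [← mul_inv_eq_one, ← map_inv, ← map_mul]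
  exact (QuotientGroup.eq_one_iff _).2 (Subgroup.subset_normalClosure ⟨u, v, h, rfl⟩)

theorem wR_one : wR (1 : Kˣ) = 1 := by simp [wR]

theorem wZ_one : wZ (1 : Kˣ) = 1 := by simp [wZ]

/-- The classes of the generators in the presented group. -/
noncomputable def presFrame (𝓡 : Set Kˣ) : Frame K (PresGroup 𝓡) where
  R a := PresGroup.mk 𝓡 (wR a)
  S := PresGroup.mk 𝓡 (wS K)
  J := PresGroup.mk 𝓡 (wJ K)
  T := PresGroup.mk 𝓡 (wT K)

/-- At a = 1 the word is empty by convention while the formula gives J²; the relation J² = 1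
reconciles them. -/
theorem presFrame_Z (𝓡 : Set Kˣ) (a : Kˣ) : (presFrame 𝓡).Z a = PresGroup.mk 𝓡 (wZ a) := by
  by_cases ha : a = 1
  · have := PresGroup.mk_eq_of_rel (Rel.J_sq (𝓡 := 𝓡))
    rw [ha, wZ_one, map_one, ← map_one (PresGroup.mk 𝓡), ← this]
    simp [Frame.Z, presFrame, wR_one]
  · simp [Frame.Z, presFrame, wZ, ha]

theorem presFrame_E (𝓡 : Set Kˣ) (a : Kˣ) : (presFrame 𝓡).E a = PresGroup.mk 𝓡 (wE a) := by
  simp [Frame.E, presFrame, wE]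

theorem presFrame_W (𝓡 : Set Kˣ) : (presFrame 𝓡).W = PresGroup.mk 𝓡 (wW K) := by
  simp [Frame.W, presFrame, wW]

/-- The presented group realizes the presentation. -/
noncomputable def presRealization (𝓡 : Set Kˣ) : Realization K 𝓡 (PresGroup 𝓡) where
  toFrame := presFrame 𝓡
  π := QuotientGroup.lift _ (FreeGroup.lift Gen.toSL) (normalClosure_relators_le_ker 𝓡)
  π_R := lift_wR
  π_S := lift_wS
  π_J := lift_wJ
  π_T := lift_wT
  R_one := by simp [presFrame, wR_one]
  S_sq := by
    rw [← pow_two, presFrame, ← map_pow, PresGroup.mk_eq_of_rel Rel.S_sq, map_one]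
  J_sq := by
    rw [← pow_two, presFrame, ← map_pow, PresGroup.mk_eq_of_rel Rel.J_sq, map_one]
  T_sq := by
    rw [← pow_two, presFrame, ← map_pow, PresGroup.mk_eq_of_rel Rel.T_sq, map_one]
  R_mul a b := by
    by_cases ha : a = 1
    · simp [presFrame, ha, wR_one]
    by_cases hb : b = 1
    · simp [presFrame, hb, wR_one]
    have h := PresGroup.mk_eq_of_rel (Rel.R_mul (𝓡 := 𝓡) a b ha hb)
    rwa [map_mul] at h
  Z_mul a b := by
    simp only [presFrame_Z]
    by_cases ha : a = 1
    · simp [ha, wZ_one]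
    by_cases hb : b = 1
    · simp [hb, wZ_one]
    simpa using PresGroup.mk_eq_of_rel (Rel.Z_mul (𝓡 := 𝓡) a b ha hb)
  comm_R_Z a b := by
    rw [presFrame_Z]
    by_cases ha : a = 1
    · simp [presFrame, ha, wR_one]
    by_cases hb : b = 1
    · simp [hb, wZ_one]
    have h := PresGroup.mk_eq_of_rel (Rel.comm_R_Z (𝓡 := 𝓡) a b ha hb)
    rwa [map_commutatorElement, map_one, commutatorElement_eq_one_iff_commute] at h
  comm_S_Z a := by
    rw [presFrame_Z]
    by_cases ha : a = 1
    · simp [ha, wZ_one]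
    have h := PresGroup.mk_eq_of_rel (Rel.comm_S_Z (𝓡 := 𝓡) a ha)
    rwa [map_commutatorElement, map_one, commutatorElement_eq_one_iff_commute] at h
  comm_S_R a ha := by
    rw [presFrame_E, ← PresGroup.mk_eq_of_rel (Rel.comm_S_R a ha), map_commutatorElement]
    rfl
  JS_cube := by
    rw [← map_one (PresGroup.mk 𝓡), ← PresGroup.mk_eq_of_rel Rel.JS_cube]
    simp [presFrame]
  TJ_cube := by
    rw [← map_one (PresGroup.mk 𝓡), ← PresGroup.mk_eq_of_rel Rel.TJ_cube]
    simp [presFrame]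
  TR_sq a := by
    -- At a = 1 the identity is T² = 1, which the presentation lists separately.
    by_cases ha : a = 1
    · rw [← map_one (PresGroup.mk 𝓡), ← PresGroup.mk_eq_of_rel Rel.T_sq]
      simp [presFrame, ha, wR_one]
    · rw [← map_one (PresGroup.mk 𝓡), ← PresGroup.mk_eq_of_rel (Rel.TR_sq a ha)]
      simp [presFrame]
  comm_Z_T a := by
    rw [presFrame_Z]
    by_cases ha : a = 1
    · simp [presFrame, ha, wR_one, wZ_one]
    · have h := PresGroup.mk_eq_of_rel (Rel.comm_Z_T (𝓡 := 𝓡) a ha)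
      rwa [map_commutatorElement, map_pow] at h
  WE_sq a ha := by
    rw [presFrame_E, presFrame_W, ← map_mul, ← map_pow, PresGroup.mk_eq_of_rel (Rel.WE_sq a ha),
      map_one]
  WJRW a ha := by
    simp only [presFrame_E, presFrame_W, presFrame_Z]
    have h := PresGroup.mk_eq_of_rel (Rel.WJRW (𝓡 := 𝓡) a ha)
    simp only [wRho, wLambda, map_mul, map_pow, map_inv] at h
    exact h

theorem presRealization_eq_top (𝓡 : Set Kˣ) (H : Subgroup (PresGroup 𝓡))
    (hR : ∀ a, (presRealization 𝓡).R a ∈ H) (hS : (presRealization 𝓡).S ∈ H)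
    (hJ : (presRealization 𝓡).J ∈ H) (hT : (presRealization 𝓡).T ∈ H) : H = ⊤ := by
  have hc : H.comap (PresGroup.mk 𝓡) = ⊤ := by
    rw [eq_top_iff, ← FreeGroup.closure_range_of, Subgroup.closure_le]
    rintro _ ⟨g, rfl⟩
    cases g with
    | R a ha =>
      have h := hR a
      have e : (presRealization 𝓡).R a = PresGroup.mk 𝓡 (FreeGroup.of (Gen.R a ha)) := by
        change PresGroup.mk 𝓡 (wR a) = _
        rw [wR, dif_neg ha]
      rwa [e] at h
    | S => exact hS
    | J => exact hJ
    | T => exact hT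
  refine eq_top_iff.2 fun g _ => ?_
  obtain ⟨w, rfl⟩ := QuotientGroup.mk'_surjective _ g
  exact (hc ▸ Subgroup.mem_top w : w ∈ H.comap (PresGroup.mk 𝓡))

end Presentation

end SL3Pres

theorem theorem5p6 {K : Type*} [Field K] (𝓡 : Set Kˣ) (h𝓡 : SL3Pres.IsCubeReps 𝓡)
    (h1 : (1 : Kˣ) ∈ 𝓡) :
    Subgroup.closure (Set.range (SL3Pres.Gen.toSL (K := K))) = ⊤ ∧
      (FreeGroup.lift (SL3Pres.Gen.toSL (K := K))).ker =
        Subgroup.normalClosure (SL3Pres.relators 𝓡) := by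
  constructor
  · rw [← FreeGroup.range_lift_eq_closure, MonoidHom.range_eq_top]
    intro M
    obtain ⟨g, rfl⟩ := (SL3Pres.presRealization 𝓡).π_surjective M
    obtain ⟨w, rfl⟩ := QuotientGroup.mk'_surjective _ g
    exact ⟨w, rfl⟩
  · refine le_antisymm (fun w hw => ?_) (SL3Pres.normalClosure_relators_le_ker 𝓡)
    have hinj := (SL3Pres.presRealization 𝓡).π_injective h𝓡
      (SL3Pres.presRealization_eq_top 𝓡)
    refine (QuotientGroup.eq_one_iff w).1 (hinj ?_)
    rw [map_one]
    exact hw
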